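/- Let $S^3\subset\mathbb{R}^4$ be the round unit sphere with its geodesic (angular) distance $d$. For a closed subgroup $G\subset O(4)$ let $S^3/G$ be the orbit space with the orbital metric $d(Gx,Gy)=\inf_{g\in G}d(x,gy)$, and let $\dim(S^3/G)$ be its dimension as an Alexandrov space, i.e. its Hausdorff dimension. (1) Among all closed subgroups $G\subset O(4)$ with $\dim(S^3/G)=1$, the minimal value of $\operatorname{diam}(S^3/G)$ is $\pi/4$: every such $G$ satisfies $\operatorname{diam}(S^3/G)\ge\pi/4$, and equality holds for some such $G$. (2) Let $T^2\subset O(4)$ be the maximal torus consisting of the block diagonal matrices $\operatorname{diag}(R_{\theta_1},R_{\theta_2})$, where $R_\theta=\begin{pmatrix}\cos\theta&\sin\theta\\-\sin\theta&\cos\theta\end{pmatrix}$, and let $w$ be the Weyl group element $(x,y,z,t)\mapsto(z,t,x,y)$. The subgroup $G$ of $O(4)$ generated by $T^2$ and $w$ is closed, $\dim(S^3/G)=1$ and $\operatorname{diam}(S^3/G)=\pi/4$. (3) Let $SO(3)\subset O(4)$ act on the first three coordinates, and let $C$ be the reflection $(x,y,z,t)\mapsto(x,y,z,-t)$. The subgroup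 $G$ of $O(4)$ generated by $SO(3)$ and $C$ is closed, $\dim(S^3/G)=1$ and $\operatorname{diam}(S^3/G)=\pi/2$. -/

import Mathlib

open scoped Matrix

noncomputable section

/-- The orthogonal group `O(4)`, topologised as a subspace of the real `4 × 4` matrices. -/
abbrev O4 : Type := Matrix.orthogonalGroup (Fin 4) ℝ

/-- The round unit three-sphere in `ℝ⁴`. -/
abbrev S3 : Type := Metric.sphere (0 : EuclideanSpace ℝ (Fin 4)) 1

theorem S3.norm_eq (x : S3) : ‖(x : EuclideanSpace ℝ (Fin 4))‖ = 1 := by simp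

theorem O4.inner_map (A : O4) (x y : EuclideanSpace ℝ (Fin 4)) :
    inner ℝ (Matrix.toEuclideanCLM (n := Fin 4) (𝕜 := ℝ) A.1 x)
      (Matrix.toEuclideanCLM (n := Fin 4) (𝕜 := ℝ) A.1 y) = inner ℝ x y := by
  have hA : star A.1 * A.1 = 1 := (Unitary.mem_iff.mp A.2).1
  rw [← ContinuousLinearMap.adjoint_inner_right, ← ContinuousLinearMap.star_eq_adjoint,
    ← map_star, ← mul_apply_eq_comp, ← map_mul, hA, map_one]
  rfl

theorem O4.norm_map (A : O4) (x : EuclideanSpace ℝ (Fin 4)) :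
    ‖Matrix.toEuclideanCLM (n := Fin 4) (𝕜 := ℝ) A.1 x‖ = ‖x‖ := by
  rw [@norm_eq_sqrt_real_inner _ _ _ x, @norm_eq_sqrt_real_inner, O4.inner_map]

/-- The standard action of `O(4)` on the three-sphere, by matrix-vector multiplication. -/
instance : MulAction O4 S3 where
  smul A x := ⟨Matrix.toEuclideanCLM (n := Fin 4) (𝕜 := ℝ) A.1 x.1, by
    rw [mem_sphere_zero_iff_norm, O4.norm_map, S3.norm_eq]⟩
  one_smul x := by
    apply Subtype.ext
    change Matrix.toEuclideanCLM (n := Fin 4) (𝕜 := ℝ) (1 : Matrix (Fin 4) (Fin 4) ℝ) x.1 = x.1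
    rw [map_one]; rfl
  mul_smul A B x := by
    apply Subtype.ext
    change Matrix.toEuclideanCLM (n := Fin 4) (𝕜 := ℝ) (A.1 * B.1) x.1 = _
    rw [map_mul]; rfl

theorem O4.coe_smul (A : O4) (x : S3) :
    ((A • x : S3) : EuclideanSpace ℝ (Fin 4)) =
      Matrix.toEuclideanCLM (n := Fin 4) (𝕜 := ℝ) A.1 x.1 := rfl

/-- The geodesic (great-circle) distance of the round unit sphere: the angle between the two
unit vectors. -/
def S3.geodist (x y : S3) : ℝ :=
  InnerProductGeometry.angle (x : EuclideanSpace ℝ (Fin 4)) (y : EuclideanSpace ℝ (Fin 4))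

theorem S3.geodist_smul (A : O4) (x y : S3) : S3.geodist (A • x) (A • y) = S3.geodist x y := by
  simp only [S3.geodist, InnerProductGeometry.angle, O4.coe_smul, O4.inner_map, O4.norm_map]

theorem S3.geodist_self (x : S3) : S3.geodist x x = 0 :=
  InnerProductGeometry.angle_self (by
    intro h; have := S3.norm_eq x; rw [h] at this; simp at this)

theorem S3.geodist_comm (x y : S3) : S3.geodist x y = S3.geodist y x :=
  InnerProductGeometry.angle_comm _ _

theorem S3.geodist_triangle (x y z : S3) :
    S3.geodist x z ≤ S3.geodist x y + S3.geodist y z :=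
  InnerProductGeometry.angle_le_angle_add_angle _ _ _

theorem S3.geodist_nonneg (x y : S3) : 0 ≤ S3.geodist x y :=
  InnerProductGeometry.angle_nonneg _ _

theorem S3.eq_of_geodist_eq_zero {x y : S3} (h : S3.geodist x y = 0) : x = y := by
  have h1 := InnerProductGeometry.inner_eq_mul_norm_of_angle_eq_zero h
  rw [S3.norm_eq, S3.norm_eq, mul_one] at h1
  exact Subtype.ext ((inner_eq_one_iff_of_norm_eq_one (S3.norm_eq x) (S3.norm_eq y)).mp h1)

theorem S3.continuous_geodist_smul (x y : S3) : Continuous fun A : O4 => S3.geodist x (A • y) := by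
  have h : Continuous fun A : O4 => ((A • y : S3) : EuclideanSpace ℝ (Fin 4)) := by
    have h1 : Continuous fun A : O4 => A.1 *ᵥ (y.1.ofLp) :=
      continuous_subtype_val.matrix_mulVec continuous_const
    exact (PiLp.continuous_toLp 2 _).comp h1
  unfold S3.geodist InnerProductGeometry.angle
  simp only [S3.norm_eq, mul_one, div_one]
  exact Real.continuous_arccos.comp (continuous_const.inner h)

instance : CompactSpace O4 := by
  refine isCompact_iff_compactSpace.mp
    (?_ : IsCompact (unitary (Matrix (Fin 4) (Fin 4) ℝ) : Set (Matrix (Fin 4) (Fin 4) ℝ)))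
  have hc : IsCompact (Set.pi Set.univ fun _ : Fin 4 => Set.pi Set.univ fun _ : Fin 4 =>
      Set.Icc (-1 : ℝ) 1) :=
    isCompact_univ_pi fun _ => isCompact_univ_pi fun _ => isCompact_Icc
  refine hc.of_isClosed_subset (isClosed_unitary (R := Matrix (Fin 4) (Fin 4) ℝ)) ?_
  intro A hA i _ j _
  have := entry_norm_bound_of_unitary (𝕜 := ℝ) hA i j
  rw [Real.norm_eq_abs, abs_le] at this
  exact this

/-- The orbit space `S³/G` of a closed subgroup `G` of `O(4)`. -/
def OrbitSpace (G : ClosedSubgroup O4) : Type := MulAction.orbitRel.Quotient G.toSubgroup S3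

/-- The distance between the orbits of `x` and `y`: the infimum of the geodesic distances from `x`
to the points of the orbit of `y` (as `G` acts by isometries, this is the infimum of the
distances between points of the two orbits). -/
def orbitDist (G : ClosedSubgroup O4) (x y : S3) : ℝ :=
  ⨅ g : G.toSubgroup, S3.geodist x ((g : O4) • y)

theorem orbitDist_bddBelow (G : ClosedSubgroup O4) (x y : S3) :
    BddBelow (Set.range fun g : G.toSubgroup => S3.geodist x ((g : O4) • y)) :=
  ⟨0, by rintro _ ⟨g, rfl⟩; exact S3.geodist_nonneg _ _⟩

theorem orbitDist_le (G : ClosedSubgroup O4) (x y : S3) (g : G.toSubgroup) :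
    orbitDist G x y ≤ S3.geodist x ((g : O4) • y) :=
  ciInf_le (orbitDist_bddBelow G x y) g

theorem exists_orbitDist_eq (G : ClosedSubgroup O4) (x y : S3) :
    ∃ g : G.toSubgroup, orbitDist G x y = S3.geodist x ((g : O4) • y) := by
  have hc : IsCompact (G.toSubgroup : Set O4) := G.isClosed'.isCompact
  obtain ⟨a, ha, hmin⟩ := hc.exists_isMinOn ⟨1, G.toSubgroup.one_mem⟩
    (S3.continuous_geodist_smul x y).continuousOn
  refine ⟨⟨a, ha⟩, le_antisymm (orbitDist_le G x y ⟨a, ha⟩) (le_ciInf fun g => ?_)⟩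
  exact hmin g.2

theorem orbitDist_comm (G : ClosedSubgroup O4) (x y : S3) :
    orbitDist G x y = orbitDist G y x := by
  have key : ∀ x y : S3, orbitDist G x y ≤ orbitDist G y x := by
    intro x y
    refine le_ciInf fun g => ?_
    refine (orbitDist_le G x y g⁻¹).trans_eq ?_
    rw [← S3.geodist_smul (g : O4) x, smul_smul, S3.geodist_comm]
    simp
  exact le_antisymm (key x y) (key y x)

theorem orbitDist_triangle (G : ClosedSubgroup O4) (x y z : S3) :
    orbitDist G x z ≤ orbitDist G x y + orbitDist G y z := by
  obtain ⟨g, hg⟩ := exists_orbitDist_eq G x y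
  obtain ⟨h, hh⟩ := exists_orbitDist_eq G y z
  rw [hg, hh]
  refine (orbitDist_le G x z (g * h)).trans ?_
  refine (S3.geodist_triangle x ((g : O4) • y) _).trans ?_
  rw [Subgroup.coe_mul, mul_smul, S3.geodist_smul]

theorem orbitDist_smul_right (G : ClosedSubgroup O4) (x y : S3) (g : G.toSubgroup) :
    orbitDist G x ((g : O4) • y) = orbitDist G x y := by
  have key : ∀ (y : S3) (g : G.toSubgroup), orbitDist G x ((g : O4) • y) ≤ orbitDist G x y := by
    intro y g
    refine le_ciInf fun h => ?_
    refine (orbitDist_le G x _ (h * g⁻¹)).trans_eq ?_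
    rw [smul_smul]; simp
  refine le_antisymm (key y g) ?_
  have := key ((g : O4) • y) g⁻¹
  rwa [smul_smul, ← Subgroup.coe_mul, inv_mul_cancel, Subgroup.coe_one, one_smul] at this

theorem orbitDist_smul_left (G : ClosedSubgroup O4) (x y : S3) (g : G.toSubgroup) :
    orbitDist G ((g : O4) • x) y = orbitDist G x y := by
  rw [orbitDist_comm, orbitDist_smul_right, orbitDist_comm]

/-- The orbital metric on `S³/G`. -/
instance (G : ClosedSubgroup O4) : MetricSpace (OrbitSpace G) where
  dist := Quotient.lift₂ (orbitDist G) (by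
    rintro _ _ x y ⟨g, rfl⟩ ⟨h, rfl⟩
    exact (orbitDist_smul_left G x _ g).trans (orbitDist_smul_right G x y h))
  dist_self := by
    rintro ⟨x⟩
    refine le_antisymm ?_ (Real.iInf_nonneg fun _ => S3.geodist_nonneg _ _)
    refine (orbitDist_le G x x 1).trans_eq ?_
    rw [Subgroup.coe_one, one_smul, S3.geodist_self]
  dist_comm := by rintro ⟨x⟩ ⟨y⟩; exact orbitDist_comm G x y
  dist_triangle := by rintro ⟨x⟩ ⟨y⟩ ⟨z⟩; exact orbitDist_triangle G x y z
  eq_of_dist_eq_zero := by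
    rintro ⟨x⟩ ⟨y⟩ hxy
    obtain ⟨g, hg⟩ := exists_orbitDist_eq G x y
    have h0 : S3.geodist x ((g : O4) • y) = 0 := hg.symm.trans hxy
    exact Quotient.sound ⟨g, (S3.eq_of_geodist_eq_zero h0).symm⟩

/-- The dimension of the orbit space `S³/G`, a compact Alexandrov space: its Hausdorff dimension
for the orbital metric. -/
def orbitSpaceDim (G : ClosedSubgroup O4) : ENNReal := dimH (Set.univ : Set (OrbitSpace G))

/-- The diameter of the orbit space `S³/G` for the orbital metric. -/
def orbitSpaceDiam (G : ClosedSubgroup O4) : ℝ := Metric.diam (Set.univ : Set (OrbitSpace G))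

/-- Pairs of plane rotations. -/
def torusMatrix (a b : ℝ) : Matrix (Fin 4) (Fin 4) ℝ :=
  !![ Real.cos a, Real.sin a, 0, 0;
     -Real.sin a, Real.cos a, 0, 0;
      0, 0,  Real.cos b, Real.sin b;
      0, 0, -Real.sin b, Real.cos b]

theorem torusMatrix_mul (a b c d : ℝ) :
    torusMatrix a b * torusMatrix c d = torusMatrix (a + c) (b + d) := by
  ext i j
  fin_cases i <;> fin_cases j <;>
    simp [torusMatrix, Matrix.mul_apply, Fin.sum_univ_four, Real.cos_add, Real.sin_add] <;> ring

theorem torusMatrix_zero : torusMatrix 0 0 = 1 := by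
  ext i j
  fin_cases i <;> fin_cases j <;> simp [torusMatrix]

theorem torusMatrix_star (a b : ℝ) : star (torusMatrix a b) = torusMatrix (-a) (-b) := by
  ext i j
  fin_cases i <;> fin_cases j <;> simp [torusMatrix, Matrix.star_apply]

/-- The maximal torus `T²` of `O(4)`. -/
def torusT2 : Subgroup O4 where
  carrier := {A | ∃ a b : ℝ, (A : Matrix (Fin 4) (Fin 4) ℝ) = torusMatrix a b}
  one_mem' := ⟨0, 0, torusMatrix_zero.symm⟩
  mul_mem' := by
    rintro A B ⟨a, b, hA⟩ ⟨c, d, hB⟩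
    refine ⟨a + c, b + d, ?_⟩
    rw [← torusMatrix_mul, ← hA, ← hB]; rfl
  inv_mem' := by
    rintro A ⟨a, b, hA⟩
    refine ⟨-a, -b, ?_⟩
    rw [← torusMatrix_star, ← hA]; rfl

/-- The element `(x, y, z, w) ↦ (z, w, x, y)` of the Weyl group, which exchanges the two circle
factors of `T²`. -/
def weylSwap : O4 :=
  ⟨!![0, 0, 1, 0;
      0, 0, 0, 1;
      1, 0, 0, 0;
      0, 1, 0, 0], by
    rw [Matrix.mem_orthogonalGroup_iff]
    ext i j
    fin_cases i <;> fin_cases j <;> simp [Matrix.mul_apply, Fin.sum_univ_four]⟩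

/-- The block matrix `diag(B, 1)`. -/
def blockMatrix (B : Matrix (Fin 3) (Fin 3) ℝ) : Matrix (Fin 4) (Fin 4) ℝ :=
  !![B 0 0, B 0 1, B 0 2, 0;
     B 1 0, B 1 1, B 1 2, 0;
     B 2 0, B 2 1, B 2 2, 0;
     0, 0, 0, 1]

theorem blockMatrix_mul (B C : Matrix (Fin 3) (Fin 3) ℝ) :
    blockMatrix B * blockMatrix C = blockMatrix (B * C) := by
  ext i j
  fin_cases i <;> fin_cases j <;>
    simp [blockMatrix, Matrix.mul_apply, Fin.sum_univ_four, Fin.sum_univ_three]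

theorem blockMatrix_one : blockMatrix 1 = 1 := by
  ext i j
  fin_cases i <;> fin_cases j <;> simp [blockMatrix]

theorem blockMatrix_star (B : Matrix (Fin 3) (Fin 3) ℝ) :
    star (blockMatrix B) = blockMatrix (star B) := by
  ext i j
  fin_cases i <;> fin_cases j <;> simp [blockMatrix, Matrix.star_apply]

/-- The subgroup `SO(3)` of `O(4)`, acting on the first three coordinates. -/
def standardSO3 : Subgroup O4 where
  carrier := {A | ∃ B ∈ Matrix.specialOrthogonalGroup (Fin 3) ℝ,
    (A : Matrix (Fin 4) (Fin 4) ℝ) = blockMatrix B}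
  one_mem' := ⟨1, one_mem _, blockMatrix_one.symm⟩
  mul_mem' := by
    rintro A A' ⟨B, hB, hA⟩ ⟨B', hB', hA'⟩
    refine ⟨B * B', mul_mem hB hB', ?_⟩
    rw [← blockMatrix_mul, ← hA, ← hA']; rfl
  inv_mem' := by
    rintro A ⟨B, hB, hA⟩
    refine ⟨star B, ?_, ?_⟩
    · rw [Matrix.mem_specialOrthogonalGroup_iff] at hB ⊢
      refine ⟨Unitary.star_mem hB.1, ?_⟩
      rw [Matrix.star_eq_conjTranspose, Matrix.det_conjTranspose, hB.2, star_one]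
    · rw [← blockMatrix_star, ← hA]; rfl

/-- The reflection `(x, y, z, w) ↦ (x, y, z, -w)`. -/
def reflectionW : O4 :=
  ⟨!![1, 0, 0, 0;
      0, 1, 0, 0;
      0, 0, 1, 0;
      0, 0, 0, -1], by
    rw [Matrix.mem_orthogonalGroup_iff]
    ext i j
    fin_cases i <;> fin_cases j <;> simp [Matrix.mul_apply, Fin.sum_univ_four]⟩

end

/-! The Lie algebra 𝔤 of G controls the dimension of S³/G. If dim 𝔤 ≤ 1, each orbit lies in finitely
many curves of bounded length, an r-tube around it has volume O(r²), and a mass distribution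
argument gives dimension at least 2 (`two_le_finrank_matrixLieAlg`). If three elements of 𝔤 move
some point in independent tangent directions, its orbit is open, hence all of S³, and the dimension
is 0 (`orbitSpaceDim_eq_zero_of_det`). Dimension 1 therefore forces dim 𝔤 ≥ 2 and det(v, Xv, Yv, Zv)
= 0 throughout.

Write skew matrices as L_a + R_b with a, b imaginary quaternions. Summing the determinants over the
standard basis, with Z a multiple of [X, Y], gives |a × c| = |b × d| for all (a, b), (c, d) in 𝔤. If
𝔤 is not abelian, this produces a common kernel vector w (`exists_common_kernel`); otherwise 𝔤 is
spanned by one L_a and one R_b (`torus_or_common_kernel`).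

With a kernel vector, every gw is orthogonal to the image of each X in 𝔤, so the diameter is at
least π/2. In the torus case G normalises 𝔤 and so preserves D = L_a R_b up to sign. Then G
preserves or exchanges the two eigenspaces of D, and a unit vector halfway between them stays at
distance at least π/4 from the orbit of an eigenvector (`pi_div_four_le_diam_of_involution`).

In both examples a geodesic segment meets every orbit and realises the orbital distances, so the
quotient is an interval of the same length (`orbitSpace_eq_interval`). -/

noncomputable section

/-! ### Lie algebras of closed subgroups in a Banach algebra. -/

section ClosedSubgroup

open Filter Topology NormedSpace

variable {𝔸 : Type*} [NormedRing 𝔸] [NormedAlgebra ℝ 𝔸] [CompleteSpace 𝔸]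

theorem NormedSpace.continuous_exp_of_real : Continuous (exp : 𝔸 → 𝔸) := by
  let _ := NormedAlgebra.restrictScalars ℚ ℝ 𝔸
  exact exp_continuous

theorem NormedSpace.exp_add_of_commute_of_real {x y : 𝔸} (h : Commute x y) :
    exp (x + y) = exp x * exp y := by
  let _ := NormedAlgebra.restrictScalars ℚ ℝ 𝔸
  exact exp_add_of_commute h

theorem NormedSpace.exp_mul_exp_neg (x : 𝔸) : exp x * exp (-x) = 1 := by
  rw [← exp_add_of_commute_of_real (Commute.refl x).neg_right, add_neg_cancel, exp_zero]

theorem NormedSpace.exp_units_conj_of_real (y : 𝔸ˣ) (x : 𝔸) :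
    exp (↑y * x * ↑y⁻¹) = ↑y * exp x * ↑y⁻¹ := by
  let _ := NormedAlgebra.restrictScalars ℚ ℝ 𝔸
  exact exp_units_conj y x

theorem NormedSpace.exp_nsmul_of_real (n : ℕ) (x : 𝔸) : exp (n • x) = exp x ^ n := by
  let _ := NormedAlgebra.restrictScalars ℚ ℝ 𝔸
  exact exp_nsmul n x

/-- A submonoid of an algebra that contains the inverses of its elements. -/
def Submonoid.InvClosed (S : Submonoid 𝔸) : Prop := ∀ ⦃a b : 𝔸⦄, a ∈ S → a * b = 1 → b ∈ S

variable {S : Submonoid 𝔸}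

theorem exp_zsmul_mem (hinv : S.InvClosed) {f : 𝔸} (hf : exp f ∈ S) (m : ℤ) : exp ((m : ℝ) • f) ∈ S := by
  have key : ∀ n : ℕ, exp ((n : ℝ) • f) ∈ S := fun n => by
    rw [Nat.cast_smul_eq_nsmul, exp_nsmul_of_real]
    exact S.pow_mem hf n
  obtain ⟨n, rfl | rfl⟩ := m.eq_nat_or_neg
  · exact_mod_cast key n
  · refine hinv (key n) ?_
    rw [← exp_mul_exp_neg ((n : ℝ) • f)]
    simp

/-- Rounding t·cᵢ down to an integer changes the multiple of fᵢ by at most ‖fᵢ‖ → 0, and integer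
multiples exponentiate into S. Closedness gives the limit. -/
theorem exp_mem_of_tendsto (hS : IsClosed (S : Set 𝔸)) (hinv : S.InvClosed)
    {ι : Type*} {l : Filter ι} [l.NeBot] {f : ι → 𝔸} {c : ι → ℝ} {Y : 𝔸}
    (hf : Tendsto f l (𝓝 0)) (hc : Tendsto (fun i => c i • f i) l (𝓝 Y))
    (hm : ∀ᶠ i in l, exp (f i) ∈ S) (t : ℝ) : exp (t • Y) ∈ S := by
  have h1 : Tendsto (fun i => ((⌊t * c i⌋ : ℤ) : ℝ) • f i) l (𝓝 (t • Y)) := by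
    have h2 : Tendsto (fun i => Int.fract (t * c i) • f i) l (𝓝 0) := by
      refine squeeze_zero_norm (a := fun i => ‖f i‖) (fun i => ?_) (by simpa using hf.norm)
      rw [norm_smul, Real.norm_eq_abs, Int.abs_fract]
      exact mul_le_of_le_one_left (norm_nonneg _) (Int.fract_lt_one _).le
    have h3 := (hc.const_smul t).sub h2
    rw [sub_zero] at h3
    refine h3.congr fun i => ?_
    rw [smul_smul, ← sub_smul, Int.self_sub_fract]
  have h4 := (continuous_exp_of_real.tendsto (t • Y)).comp h1
  exact hS.mem_of_tendsto h4 (hm.mono fun i hi => exp_zsmul_mem hinv hi _)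

/-- The local logarithm of γ(h), rescaled by 1/h, tends to the velocity Z, so the preceding limit
principle applies. This yields closure of the Lie algebra under addition. -/
theorem exp_mem_of_hasDerivAt (hS : IsClosed (S : Set 𝔸)) (hinv : S.InvClosed)
    {γ : ℝ → 𝔸} {Z : 𝔸} (h0 : γ 0 = 1) (hd : HasDerivAt γ Z 0)
    (hm : ∀ h, γ h ∈ S) (t : ℝ) : exp (t • Z) ∈ S := by
  have he : HasStrictFDerivAt (exp : 𝔸 → 𝔸) ((ContinuousLinearEquiv.refl ℝ 𝔸 : 𝔸 ≃L[ℝ] 𝔸) :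
      𝔸 →L[ℝ] 𝔸) 0 := hasStrictFDerivAt_exp_zero
  set lg := he.localInverse with hlg
  have hl : HasFDerivAt lg (ContinuousLinearMap.id ℝ 𝔸) (γ 0) := by
    have := he.to_localInverse.hasFDerivAt
    rw [exp_zero] at this
    rw [h0]; exact this
  have hl0 : lg (γ 0) = 0 := by
    rw [h0, ← exp_zero (𝔸 := 𝔸)]
    exact he.localInverse_apply_image
  have hr : ∀ᶠ y in 𝓝 (γ 0), exp (lg y) = y := by
    rw [h0, ← exp_zero (𝔸 := 𝔸)]
    exact he.eventually_right_inverse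
  have hcomp : HasDerivAt (lg ∘ γ) Z 0 := hl.comp_hasDerivAt 0 hd
  refine exp_mem_of_tendsto hS hinv (l := 𝓝[≠] (0 : ℝ)) (f := lg ∘ γ) (c := fun h => h⁻¹)
    ?_ ?_ ?_ t
  · have := hcomp.continuousAt.tendsto
    simp only [Function.comp, hl0] at this
    exact this.mono_left nhdsWithin_le_nhds
  · have := hcomp.tendsto_slope_zero
    simpa [hl0] using this
  · have := (hd.continuousAt.tendsto.eventually hr)
    filter_upwards [nhdsWithin_le_nhds this] with h hh
    simp only [Function.comp, hh]
    exact hm h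

theorem hasDerivAt_exp_smul_zero (X : 𝔸) : HasDerivAt (fun t : ℝ => exp (t • X)) X 0 := by
  simpa using hasDerivAt_exp_smul_const (𝕂 := ℝ) X 0

/-- The Lie algebra of a closed subgroup of the group of units of a Banach algebra. -/
def lieAlg (S : Submonoid 𝔸) (hS : IsClosed (S : Set 𝔸)) (hinv : S.InvClosed) :
    Submodule ℝ 𝔸 where
  carrier := {X | ∀ t : ℝ, exp (t • X) ∈ S}
  zero_mem' t := by simp
  add_mem' {X Y} hX hY t := by
    refine exp_mem_of_hasDerivAt hS hinv (γ := fun h => exp (h • X) * exp (h • Y)) (by simp) ?_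
      (fun h => S.mul_mem (hX h) (hY h)) t
    have := (hasDerivAt_exp_smul_zero X).fun_mul (hasDerivAt_exp_smul_zero Y)
    simpa using this
  smul_mem' c X hX t := by
    rw [smul_smul]; exact hX _

variable (hS : IsClosed (S : Set 𝔸)) (hinv : S.InvClosed)

theorem conj_mem_lieAlg {g g' X : 𝔸} (hg : g ∈ S) (h : g * g' = 1) (h' : g' * g = 1)
    (hX : X ∈ lieAlg S hS hinv) : g * X * g' ∈ lieAlg S hS hinv := by
  intro t
  have := exp_units_conj_of_real (⟨g, g', h, h'⟩ : 𝔸ˣ) (t • X)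
  simp only [mul_smul_comm, smul_mul_assoc, Units.inv_mk] at this
  rw [this]
  exact S.mul_mem (S.mul_mem hg (hX t)) (hinv hg h)

variable [FiniteDimensional ℝ 𝔸]

/-- The bracket is the derivative at 0 of the conjugates of Y by exp(tX). The difference quotients
lie in the Lie algebra, which is closed as a finite-dimensional subspace. -/
theorem bracket_mem_lieAlg {X Y : 𝔸} (hX : X ∈ lieAlg S hS hinv) (hY : Y ∈ lieAlg S hS hinv) :
    X * Y - Y * X ∈ lieAlg S hS hinv := by
  have hcl : IsClosed (lieAlg S hS hinv : Set 𝔸) := Submodule.closed_of_finiteDimensional _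
  have hd : HasDerivAt (fun t : ℝ => exp (t • X) * Y * exp (t • (-X))) (X * Y - Y * X) 0 := by
    have := ((hasDerivAt_exp_smul_zero X).mul_const Y).fun_mul (hasDerivAt_exp_smul_zero (-X))
    simpa [sub_eq_add_neg] using this
  refine hcl.mem_of_tendsto hd.tendsto_slope_zero (Eventually.of_forall fun t => ?_)
  refine Submodule.smul_mem _ _ (Submodule.sub_mem _ ?_ ?_)
  · have e : exp ((0 + t) • X) * exp ((0 + t) • -X) = 1 := by
      rw [smul_neg, exp_mul_exp_neg]
    have e' : exp ((0 + t) • -X) * exp ((0 + t) • X) = 1 := by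
      simpa using exp_mul_exp_neg ((0 + t) • -X)
    exact conj_mem_lieAlg hS hinv (hX _) e e' hY
  · simpa using hY

/-- The closed subgroup theorem. For a complement V of 𝔤, the map (X, v) ↦ exp X · exp v covers a
neighbourhood of 1, and the factor exp v must be trivial when the product lies in S. The norm bound
lets compactness later reduce the group to finitely many bounded pieces. -/
theorem eventually_mem_exp_lieAlg :
    ∀ᶠ g in 𝓝 (1 : 𝔸), g ∈ S → ∃ X ∈ lieAlg S hS hinv, ‖X‖ ≤ 1 ∧ exp X = g := by
  set 𝔤 := lieAlg S hS hinv with h𝔤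
  obtain ⟨V, hV⟩ := 𝔤.exists_isCompl
  have hVcl : IsClosed (V : Set 𝔸) := Submodule.closed_of_finiteDimensional _
  -- Otherwise normalised vectors of V shrinking to 0 would accumulate at a unit vector lying in
  -- both 𝔤 and V.
  have hVev : ∀ᶠ v in 𝓝 (0 : 𝔸), v ∈ V → exp v ∈ S → v = 0 := by
    by_contra hcon
    have hfr : ∃ᶠ v in 𝓝 (0 : 𝔸), v ∈ V ∧ exp v ∈ S ∧ v ≠ 0 := by
      rw [Filter.not_eventually] at hcon
      exact hcon.mono fun v hv => by push Not at hv; exact hv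
    obtain ⟨v, hv0, hv⟩ := Filter.exists_seq_forall_of_frequently hfr
    have hsph : ∀ n, (‖v n‖⁻¹ • v n) ∈ Metric.sphere (0 : 𝔸) 1 := fun n => by
      simp [norm_smul, (hv n).2.2]
    have : ProperSpace 𝔸 := FiniteDimensional.proper ℝ 𝔸
    obtain ⟨Y, hY, φ, hφ, hlim⟩ := (isCompact_sphere (0 : 𝔸) 1).tendsto_subseq hsph
    have hYg : Y ∈ 𝔤 := fun t => exp_mem_of_tendsto hS hinv (f := v ∘ φ)
      (c := fun n => ‖v (φ n)‖⁻¹) (hv0.comp hφ.tendsto_atTop) hlim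
      (Eventually.of_forall fun n => (hv _).2.1) t
    have hYV : Y ∈ V := hVcl.mem_of_tendsto hlim
      (Eventually.of_forall fun n => V.smul_mem _ (hv _).1)
    have hY0 : Y = 0 := by
      have := hV.disjoint.le_bot ⟨hYg, hYV⟩
      simpa using this
    simp [hY0] at hY
  let F : 𝔤 × V → 𝔸 := fun p => exp (p.1 : 𝔸) * exp (p.2 : 𝔸)
  have hexp : HasStrictFDerivAt (exp : 𝔸 → 𝔸) (ContinuousLinearMap.id ℝ 𝔸) 0 :=
    hasStrictFDerivAt_exp_zero
  have hF : HasStrictFDerivAt F (𝔤.subtypeL.comp (ContinuousLinearMap.fst ℝ 𝔤 V) +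
      V.subtypeL.comp (ContinuousLinearMap.snd ℝ 𝔤 V)) 0 := by
    have h1 : HasStrictFDerivAt (fun p : 𝔤 × V => exp (p.1 : 𝔸))
        (𝔤.subtypeL.comp (ContinuousLinearMap.fst ℝ 𝔤 V)) 0 := by
      have := HasStrictFDerivAt.comp (0 : 𝔤 × V) (f := fun p : 𝔤 × V => (p.1 : 𝔸)) (g := exp)
        (g' := ContinuousLinearMap.id ℝ 𝔸) (by simpa using hexp)
        (𝔤.subtypeL.comp (ContinuousLinearMap.fst ℝ 𝔤 V)).hasStrictFDerivAt
      simpa using this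
    have h2 : HasStrictFDerivAt (fun p : 𝔤 × V => exp (p.2 : 𝔸))
        (V.subtypeL.comp (ContinuousLinearMap.snd ℝ 𝔤 V)) 0 := by
      have := HasStrictFDerivAt.comp (0 : 𝔤 × V) (f := fun p : 𝔤 × V => (p.2 : 𝔸)) (g := exp)
        (g' := ContinuousLinearMap.id ℝ 𝔸) (by simpa using hexp)
        (V.subtypeL.comp (ContinuousLinearMap.snd ℝ 𝔤 V)).hasStrictFDerivAt
      simpa using this
    refine (h1.mul' h2).congr_fderiv ?_
    ext p <;> simp
  have hsurj : (𝔤.subtypeL.comp (ContinuousLinearMap.fst ℝ 𝔤 V) +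
      V.subtypeL.comp (ContinuousLinearMap.snd ℝ 𝔤 V)).range = ⊤ := by
    rw [eq_top_iff]
    intro z _
    have hz : z ∈ 𝔤 ⊔ V := by rw [hV.sup_eq_top]; trivial
    obtain ⟨x, hx, y, hy, rfl⟩ := Submodule.mem_sup.mp hz
    exact ⟨(⟨x, hx⟩, ⟨y, hy⟩), by simp⟩
  have hmap := hF.map_nhds_eq_of_surj hsurj
  have hF0 : F 0 = 1 := by simp [F]
  rw [hF0] at hmap
  rw [← hmap, Filter.eventually_map]
  have c1 : Tendsto (fun p : 𝔤 × V => (p.2 : 𝔸)) (𝓝 0) (𝓝 0) :=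
    (by fun_prop : Continuous fun p : 𝔤 × V => (p.2 : 𝔸)).tendsto' _ _ (by simp)
  have c2 : Tendsto (fun p : 𝔤 × V => ‖(p.1 : 𝔸)‖) (𝓝 0) (𝓝 0) :=
    (by fun_prop : Continuous fun p : 𝔤 × V => ‖(p.1 : 𝔸)‖).tendsto' _ _ (by simp)
  filter_upwards [c1.eventually hVev, c2.eventually (ge_mem_nhds one_pos)] with p hp1 hp2 hpS
  refine ⟨p.1, p.1.2, hp2, ?_⟩
  have hpe : exp (p.1 : 𝔸) ∈ S := by simpa using p.1.2 1
  have hne : exp (-(p.1 : 𝔸)) ∈ S := hinv hpe (exp_mul_exp_neg _)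
  have h2 : exp (p.2 : 𝔸) ∈ S := by
    have := S.mul_mem hne hpS
    simp only [F] at this
    rw [← mul_assoc] at this
    have e' : exp (-(p.1 : 𝔸)) * exp (p.1 : 𝔸) = 1 := by
      simpa using exp_mul_exp_neg (-(p.1 : 𝔸))
    rwa [e', one_mul] at this
  simp [F, hp1 p.2.2 h2]

end ClosedSubgroup

end

/-! ### Small orbits force a quotient of dimension at least two. -/

noncomputable section

section OrbitSpaceDimension

open MeasureTheory Topology

local notation "E4" => EuclideanSpace ℝ (Fin 4)
local notation "E3" => EuclideanSpace ℝ (Fin 3)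

theorem S3.inner_eq_cos_geodist (x y : S3) :
    inner ℝ (x : E4) (y : E4) = Real.cos (S3.geodist x y) := by
  rw [S3.geodist, InnerProductGeometry.cos_angle, S3.norm_eq, S3.norm_eq]; simp

theorem S3.norm_sub_le_geodist (x y : S3) : ‖(x : E4) - y‖ ≤ S3.geodist x y := by
  refine abs_le_of_sq_le_sq' ?_ (S3.geodist_nonneg x y) |>.2
  rw [@norm_sub_sq_real, S3.norm_eq, S3.norm_eq, S3.inner_eq_cos_geodist]
  have := Real.one_sub_sq_div_two_le_cos (x := S3.geodist x y)
  linarith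

theorem S3.geodist_le_pi (x y : S3) : S3.geodist x y ≤ Real.pi :=
  InnerProductGeometry.angle_le_pi _ _

theorem S3.continuous_geodist (x : S3) : Continuous fun y : S3 => S3.geodist y x := by
  unfold S3.geodist InnerProductGeometry.angle
  simp only [S3.norm_eq, mul_one, div_one]
  fun_prop

/-- The orbit of a point of the sphere, as a point of the orbit space. -/
def OrbitSpace.mk (G : ClosedSubgroup O4) (x : S3) : OrbitSpace G := Quotient.mk _ x

theorem OrbitSpace.dist_mk (G : ClosedSubgroup O4) (x y : S3) :
    dist (OrbitSpace.mk G x) (OrbitSpace.mk G y) = orbitDist G x y := rfl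

theorem OrbitSpace.mk_surjective (G : ClosedSubgroup O4) :
    Function.Surjective (OrbitSpace.mk G) := Quotient.mk_surjective

theorem OrbitSpace.dist_mk_le (G : ClosedSubgroup O4) (x y : S3) :
    dist (OrbitSpace.mk G x) (OrbitSpace.mk G y) ≤ S3.geodist x y := by
  have := orbitDist_le G x y 1
  rwa [Subgroup.coe_one, one_smul] at this

theorem OrbitSpace.continuous_mk (G : ClosedSubgroup O4) : Continuous (OrbitSpace.mk G) := by
  rw [continuous_iff_continuousAt]
  intro x
  rw [ContinuousAt, tendsto_iff_dist_tendsto_zero]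
  refine squeeze_zero (fun _ => dist_nonneg) (fun y => OrbitSpace.dist_mk_le G y x) ?_
  have := (S3.continuous_geodist x).tendsto x
  rwa [S3.geodist_self] at this

theorem OrbitSpace.isBounded_univ (G : ClosedSubgroup O4) :
    Bornology.IsBounded (Set.univ : Set (OrbitSpace G)) := by
  rw [Metric.isBounded_iff]
  refine ⟨Real.pi, fun p _ q _ => ?_⟩
  obtain ⟨x, rfl⟩ := OrbitSpace.mk_surjective G p
  obtain ⟨y, rfl⟩ := OrbitSpace.mk_surjective G q
  exact (OrbitSpace.dist_mk_le G x y).trans (S3.geodist_le_pi x y)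

theorem le_orbitSpaceDiam (G : ClosedSubgroup O4) (x y : S3) (c : ℝ)
    (h : ∀ g ∈ G.toSubgroup, c ≤ S3.geodist x (g • y)) : c ≤ orbitSpaceDiam G :=
  (le_ciInf fun g : G.toSubgroup => h (g : O4) g.2).trans <| (OrbitSpace.dist_mk G x y).symm.le.trans <|
    Metric.dist_le_diam_of_mem (OrbitSpace.isBounded_univ G) trivial trivial

/-- The closed unit ball of `ℝ³` as a hemisphere of the three-sphere. -/
def hemisphere (u : Metric.closedBall (0 : E3) 1) : S3 :=
  ⟨!₂[u.1 0, u.1 1, u.1 2, √(1 - ‖u.1‖ ^ 2)], by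
    have hu : ‖u.1‖ ≤ 1 := mem_closedBall_zero_iff.mp u.2
    have h1 : 0 ≤ 1 - ‖u.1‖ ^ 2 := by nlinarith [norm_nonneg u.1]
    rw [mem_sphere_zero_iff_norm, EuclideanSpace.norm_eq, Real.sqrt_eq_one]
    simp only [Fin.sum_univ_four, Real.norm_eq_abs, sq_abs]
    simp [Real.sq_sqrt h1]
    rw [EuclideanSpace.real_norm_sq_eq, Fin.sum_univ_three]
    ring⟩

theorem continuous_hemisphere : Continuous hemisphere := by
  refine Continuous.subtype_mk ?_ _
  refine (PiLp.continuous_toLp 2 _).comp (continuous_pi fun i => ?_)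
  fin_cases i <;> simp <;> fun_prop

theorem norm_sub_projection_le (u : Metric.closedBall (0 : E3) 1) (p : E4) :
    ‖u.1 - !₂[p 0, p 1, p 2]‖ ≤ ‖(hemisphere u : E4) - p‖ := by
  refine abs_le_of_sq_le_sq' ?_ (norm_nonneg _) |>.2
  rw [EuclideanSpace.real_norm_sq_eq, EuclideanSpace.real_norm_sq_eq, Fin.sum_univ_three,
    Fin.sum_univ_four]
  simp [hemisphere]
  positivity

/-- Mass distribution principle: Lebesgue measure of the unit ball of ℝ³ is pushed to the orbit
space through the hemisphere. The preimage of an r-ball is within r of an orbit, so it is covered by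
C/r Euclidean balls of radius 2r and has volume O(r²). Vertical projection is 1-Lipschitz, so no
measure on the sphere is needed. -/
theorem two_le_orbitSpaceDim (G : ClosedSubgroup O4) (C : ℝ)
    (hC : ∀ (x : S3) (r : ℝ), 0 < r → r ≤ 1 → ∃ N : Finset E4, (N.card : ℝ) ≤ C / r ∧
      ∀ g ∈ G.toSubgroup, ∃ p ∈ N, ‖((g • x : S3) : E4) - p‖ ≤ r) :
    2 ≤ orbitSpaceDim G := by
  borelize (OrbitSpace G)
  set B := Metric.closedBall (0 : E3) 1 with hB
  have hemb : MeasurableEmbedding (Subtype.val : B → E3) :=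
    MeasurableEmbedding.subtype_coe Metric.isClosed_closedBall.measurableSet
  set f : B → OrbitSpace G := OrbitSpace.mk G ∘ hemisphere with hf
  have hfc : Continuous f := (OrbitSpace.continuous_mk G).comp continuous_hemisphere
  set ν : Measure (OrbitSpace G) := (Measure.comap Subtype.val (volume : Measure E3)).map f with hν
  have hC0 : 0 ≤ C := by
    obtain ⟨N, hN, -⟩ := hC (hemisphere ⟨0, by simp⟩) 1 one_pos le_rfl
    exact (Nat.cast_nonneg _).trans (by simpa using hN)
  set V := (volume (Metric.ball (0 : E3) 1)).toReal with hV
  have hVtop : volume (Metric.ball (0 : E3) 1) ≠ ⊤ := measure_ball_lt_top.ne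
  have hball : ∀ (q : OrbitSpace G) (r : ℝ), 0 < r → r ≤ 1 →
      ν (Metric.closedBall q r) ≤ ENNReal.ofReal (8 * C * V * r ^ 2) := by
    intro q r hr hr1
    obtain ⟨x, rfl⟩ := OrbitSpace.mk_surjective G q
    obtain ⟨N, hN, hNg⟩ := hC x r hr hr1
    rw [hν, Measure.map_apply hfc.measurable Metric.isClosed_closedBall.measurableSet,
      hemb.comap_apply]
    have hsub : Subtype.val '' (f ⁻¹' Metric.closedBall (OrbitSpace.mk G x) r) ⊆
        ⋃ p ∈ N, Metric.closedBall (!₂[p 0, p 1, p 2] : E3) (2 * r) := by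
      rintro _ ⟨u, hu, rfl⟩
      rw [Set.mem_preimage, Metric.mem_closedBall, hf, Function.comp, OrbitSpace.dist_mk] at hu
      obtain ⟨g, hg⟩ := exists_orbitDist_eq G (hemisphere u) x
      obtain ⟨p, hp, hgp⟩ := hNg g g.2
      simp only [Set.mem_iUnion]
      refine ⟨p, hp, ?_⟩
      rw [mem_closedBall_iff_norm]
      refine (norm_sub_projection_le u p).trans ?_
      have h1 := S3.norm_sub_le_geodist (hemisphere u) ((g : O4) • x)
      have h2 := norm_sub_le_norm_sub_add_norm_sub (hemisphere u : E4) (((g : O4) • x : S3) : E4) p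
      linarith
    refine (measure_mono hsub).trans ((measure_biUnion_finset_le _ _).trans ?_)
    simp only [Measure.addHaar_closedBall volume _ (by positivity : 0 ≤ 2 * r),
      finrank_euclideanSpace, Fintype.card_fin, Finset.sum_const, nsmul_eq_mul]
    rw [← ENNReal.ofReal_toReal hVtop, ← hV, ← ENNReal.ofReal_mul (by positivity),
      ← ENNReal.ofReal_natCast, ← ENNReal.ofReal_mul (by positivity)]
    apply ENNReal.ofReal_le_ofReal
    have hV0 : 0 ≤ V := ENNReal.toReal_nonneg
    calc (N.card : ℝ) * ((2 * r) ^ 3 * V) ≤ C / r * ((2 * r) ^ 3 * V) := by gcongr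
      _ = 8 * C * V * r ^ 2 := by field_simp; ring
  -- The added 1 keeps the constant positive, so that ν can be divided by it.
  set K := 8 * C * V + 1 with hK
  have hK0 : 0 < K := by have : 0 ≤ V := ENNReal.toReal_nonneg
                         positivity
  have hs : ∀ s : Set (OrbitSpace G), Metric.ediam s ≤ 1 →
      ν s ≤ ENNReal.ofReal K * Metric.ediam s ^ (2 : ℝ) := by
    intro s hs1
    obtain rfl | ⟨q, hq⟩ := s.eq_empty_or_nonempty
    · simp
    have htop : Metric.ediam s ≠ ⊤ := (hs1.trans_lt ENNReal.one_lt_top).ne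
    set d := (Metric.ediam s).toReal with hd
    have hd1 : d ≤ 1 := by
      have := ENNReal.toReal_mono ENNReal.one_ne_top hs1
      simpa using this
    have hd0 : 0 ≤ d := ENNReal.toReal_nonneg
    have hsb : ∀ r, d ≤ r → s ⊆ Metric.closedBall q r := fun r hr y hy => by
      rw [Metric.mem_closedBall, dist_edist]
      exact (ENNReal.toReal_mono htop (Metric.edist_le_ediam_of_mem hy hq)).trans hr
    have hb2 : ∀ r, 0 < r → r ≤ 1 → d ≤ r → ν s ≤ ENNReal.ofReal (K * r ^ 2) := by
      intro r hr hr1 hdr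
      refine (measure_mono (hsb r hdr)).trans ((hball q r hr hr1).trans ?_)
      apply ENNReal.ofReal_le_ofReal
      nlinarith [sq_nonneg r]
    rw [← ENNReal.ofReal_toReal htop, ← hd, ENNReal.ofReal_rpow_of_nonneg hd0 (by norm_num),
      ← ENNReal.ofReal_mul hK0.le, Real.rpow_two]
    -- The ball estimate needs a positive radius, so sets of diameter 0 are handled by letting r →
    -- 0.
    rcases hd0.eq_or_lt with h0 | h0
    · rw [← h0] at hb2 ⊢
      have hlim : Filter.Tendsto (fun r : ℝ => ENNReal.ofReal (K * r ^ 2)) (𝓝[>] 0)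
          (𝓝 (ENNReal.ofReal (K * 0 ^ 2))) := by
        have : Continuous fun r : ℝ => ENNReal.ofReal (K * r ^ 2) :=
          ENNReal.continuous_ofReal.comp (by fun_prop)
        exact (this.tendsto 0).mono_left nhdsWithin_le_nhds
      refine ge_of_tendsto hlim ?_
      filter_upwards [Ioc_mem_nhdsGT (one_pos : (0 : ℝ) < 1)] with r hr
      exact hb2 r hr.1 hr.2 hr.1.le
    · exact hb2 d h0 hd1 le_rfl
  have hle := Measure.le_hausdorffMeasure 2 ((ENNReal.ofReal K)⁻¹ • ν) 1 one_pos (fun s hs1 => by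
    rw [Measure.smul_apply, smul_eq_mul]
    refine (mul_le_mul_right (hs s hs1) _).trans ?_
    rw [← mul_assoc, ENNReal.inv_mul_cancel (by simpa using hK0) ENNReal.ofReal_ne_top, one_mul])
  have hpos : ν Set.univ ≠ 0 := by
    rw [hν, Measure.map_apply hfc.measurable MeasurableSet.univ, hemb.comap_apply]
    simp only [Set.preimage_univ, Set.image_univ, Subtype.range_coe_subtype, Set.ofPred_mem_eq]
    exact (Metric.measure_closedBall_pos volume _ one_pos).ne'
  refine le_dimH_of_hausdorffMeasure_ne_zero (d := 2) fun h0 => ?_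
  have h1 := hle Set.univ
  rw [NNReal.coe_ofNat] at h0
  rw [h0, Measure.smul_apply, smul_eq_mul, nonpos_iff_eq_zero, mul_eq_zero] at h1
  rcases h1 with h1 | h1
  · simp at h1
  · exact hpos h1

end OrbitSpaceDimension

end

/-! ### Skew-symmetric matrices as pairs of imaginary quaternions. -/

noncomputable section

section QuaternionMatrices

open Matrix

/-- Left multiplication by a purely imaginary quaternion. -/
def quatL (a : Fin 3 → ℝ) : Matrix (Fin 4) (Fin 4) ℝ :=
  !![0, -a 0, -a 1, -a 2; a 0, 0, -a 2, a 1; a 1, a 2, 0, -a 0; a 2, -a 1, a 0, 0]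

/-- Right multiplication by a purely imaginary quaternion. -/
def quatR (b : Fin 3 → ℝ) : Matrix (Fin 4) (Fin 4) ℝ :=
  !![0, -b 0, -b 1, -b 2; b 0, 0, b 2, -b 1; b 1, -b 2, 0, b 0; b 2, b 1, -b 0, 0]

/-- The parametrisation of the skew-symmetric matrices by pairs of imaginary quaternions. -/
def quatLR : ((Fin 3 → ℝ) × (Fin 3 → ℝ)) →ₗ[ℝ] Matrix (Fin 4) (Fin 4) ℝ where
  toFun p := quatL p.1 + quatR p.2
  map_add' p q := by
    ext i j; fin_cases i <;> fin_cases j <;> simp [quatL, quatR] <;> ring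
  map_smul' c p := by
    ext i j; fin_cases i <;> fin_cases j <;> simp [quatL, quatR] <;> ring

theorem quatLR_apply (a b : Fin 3 → ℝ) : quatLR (a, b) = quatL a + quatR b := rfl

theorem quatL_zero : quatL 0 = 0 := by
  ext i j; fin_cases i <;> fin_cases j <;> simp [quatL]

theorem quatR_zero : quatR 0 = 0 := by
  ext i j; fin_cases i <;> fin_cases j <;> simp [quatR]

/-- The splitting of so(4) into its two commuting so(3) factors, with half-sums and half-differences
of entries as coordinates. -/
theorem exists_quatLR_of_skew {X : Matrix (Fin 4) (Fin 4) ℝ} (hX : Xᵀ = -X) :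
    ∃ p, quatLR p = X := by
  have h : ∀ i j, X j i = -X i j := fun i j => congrFun (congrFun hX i) j
  have hd : ∀ i, X i i = 0 := fun i => by linarith [h i i]
  refine ⟨(![(X 1 0 + X 3 2) / 2, (X 2 0 - X 3 1) / 2, (X 3 0 + X 2 1) / 2],
    ![(X 1 0 - X 3 2) / 2, (X 2 0 + X 3 1) / 2, (X 3 0 - X 2 1) / 2]), ?_⟩
  ext i j
  fin_cases i <;> fin_cases j <;>
    simp [quatLR, quatL, quatR, hd, h 0 1, h 0 2, h 0 3, h 1 2, h 1 3, h 2 3] <;> ring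

theorem quatL_mul_self (a : Fin 3 → ℝ) : quatL a * quatL a = -(a ⬝ᵥ a) • 1 := by
  ext i j
  fin_cases i <;> fin_cases j <;>
    simp [quatL, Matrix.mul_apply, Fin.sum_univ_four, dotProduct, Fin.sum_univ_three] <;> ring

theorem quatR_mul_self (a : Fin 3 → ℝ) : quatR a * quatR a = -(a ⬝ᵥ a) • 1 := by
  ext i j
  fin_cases i <;> fin_cases j <;>
    simp [quatR, Matrix.mul_apply, Fin.sum_univ_four, dotProduct, Fin.sum_univ_three] <;> ring

theorem quatR_mul_quatL (a b : Fin 3 → ℝ) : quatR b * quatL a = quatL a * quatR b := by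
  ext i j
  fin_cases i <;> fin_cases j <;>
    simp [quatL, quatR, Matrix.mul_apply, Fin.sum_univ_four] <;> ring

theorem quatL_mul_comm (a c : Fin 3 → ℝ) :
    quatL c * quatL a = -(quatL a * quatL c) - (2 * (a ⬝ᵥ c)) • 1 := by
  ext i j
  fin_cases i <;> fin_cases j <;>
    simp [quatL, Matrix.mul_apply, Fin.sum_univ_four, dotProduct, Fin.sum_univ_three] <;> ring

theorem quatR_mul_comm (a c : Fin 3 → ℝ) :
    quatR c * quatR a = -(quatR a * quatR c) - (2 * (a ⬝ᵥ c)) • 1 := by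
  ext i j
  fin_cases i <;> fin_cases j <;>
    simp [quatR, Matrix.mul_apply, Fin.sum_univ_four, dotProduct, Fin.sum_univ_three] <;> ring

theorem quatL_bracket (a c : Fin 3 → ℝ) :
    quatL a * quatL c - quatL c * quatL a = (2 : ℝ) • quatL (a ⨯₃ c) := by
  ext i j
  fin_cases i <;> fin_cases j <;> simp [quatL, cross_apply] <;> ring

theorem quatR_bracket (b d : Fin 3 → ℝ) :
    quatR b * quatR d - quatR d * quatR b = (2 : ℝ) • quatR (-(b ⨯₃ d)) := by
  ext i j
  fin_cases i <;> fin_cases j <;> simp [quatR, cross_apply] <;> ring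

theorem quatLR_bracket (a b c d : Fin 3 → ℝ) :
    quatLR (a, b) * quatLR (c, d) - quatLR (c, d) * quatLR (a, b) =
      (2 : ℝ) • quatLR (a ⨯₃ c, -(b ⨯₃ d)) := by
  rw [quatLR_apply, quatLR_apply, quatLR_apply, smul_add, ← quatL_bracket, ← quatR_bracket]
  simp only [add_mul, mul_add, quatR_mul_quatL]
  abel

theorem trace_quatL_mul_quatR (a b : Fin 3 → ℝ) : (quatL a * quatR b).trace = 0 := by
  simp [Matrix.trace, quatL, quatR, Fin.sum_univ_four]
  ring

theorem transpose_quatL (a : Fin 3 → ℝ) : (quatL a)ᵀ = -quatL a := by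
  ext i j; fin_cases i <;> fin_cases j <;> simp [quatL]

theorem transpose_quatR (a : Fin 3 → ℝ) : (quatR a)ᵀ = -quatR a := by
  ext i j; fin_cases i <;> fin_cases j <;> simp [quatR]

/-- Each determinant tests whether three fields span the tangent space at a basis vector. Summing
them leaves a quantity expressed by the triple products of the two factors. -/
theorem sum_det_rows_quatLR (a b c d e f : Fin 3 → ℝ) :
    ∑ i : Fin 4, det (of ![Pi.single i 1, quatLR (a, b) *ᵥ Pi.single i 1,
      quatLR (c, d) *ᵥ Pi.single i 1, quatLR (e, f) *ᵥ Pi.single i (1 : ℝ)]) =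
      4 * (a ⬝ᵥ c ⨯₃ e + b ⬝ᵥ d ⨯₃ f) := by
  rw [Fin.sum_univ_four]
  simp [quatLR, quatL, quatR, det_succ_row_zero, Fin.sum_univ_succ, Matrix.submatrix,
    dotProduct, cross_apply, Fin.succAbove]
  ring

end QuaternionMatrices
end

/-! ### Classification of the possible Lie algebras. -/

noncomputable section

section SkewLieAlgebras

open Matrix

local notation "V3" => Fin 3 → ℝ
local notation "M4" => Matrix (Fin 4) (Fin 4) ℝ

theorem cross_dotProduct_self_add (a c : V3) :
    (a ⨯₃ c) ⬝ᵥ (a ⨯₃ c) + (a ⬝ᵥ c) ^ 2 = (a ⬝ᵥ a) * (c ⬝ᵥ c) := by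
  rw [cross_dot_cross, dotProduct_comm c a]; ring

theorem eq_zero_of_cross_eq_zero {q b d : V3} (h1 : q ⨯₃ b = 0) (h2 : q ⨯₃ d = 0)
    (h : b ⨯₃ d ≠ 0) : q = 0 := by
  have e1 : q ⨯₃ (b ⨯₃ d) = 0 := by rw [leibniz_cross, h1, h2]; simp
  have e2 : q ⬝ᵥ b ⨯₃ d = 0 := by
    rw [← triple_product_permutation, h1, dotProduct_zero]
  have e3 := cross_dotProduct_self_add q (b ⨯₃ d)
  rw [e1, e2] at e3
  simp only [dotProduct_zero, ne_eq, OfNat.ofNat_ne_zero, not_false_eq_true, zero_pow,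
    add_zero] at e3
  rcases mul_eq_zero.mp e3.symm with h3 | h3
  · exact dotProduct_self_eq_zero.mp h3
  · exact absurd (dotProduct_self_eq_zero.mp h3) h

/-- Expansion of p in a, c and a × c, cleared of the Gram determinant in the denominator. -/
theorem cross_dotProduct_self_smul (a c p : V3) :
    ((a ⨯₃ c) ⬝ᵥ (a ⨯₃ c)) • p =
      ((c ⬝ᵥ c) * (p ⬝ᵥ a) - (a ⬝ᵥ c) * (p ⬝ᵥ c)) • a +
      ((a ⬝ᵥ a) * (p ⬝ᵥ c) - (a ⬝ᵥ c) * (p ⬝ᵥ a)) • c + (p ⬝ᵥ a ⨯₃ c) • (a ⨯₃ c) := by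
  ext i
  fin_cases i <;> simp [dotProduct, cross_apply, Fin.sum_univ_three] <;> ring

theorem exists_unit_le_span (W : Submodule ℝ V3) (hW : ∀ a ∈ W, ∀ c ∈ W, a ⨯₃ c = 0) :
    ∃ a : V3, a ⬝ᵥ a = 1 ∧ ∀ c ∈ W, ∃ s : ℝ, c = s • a := by
  by_cases h : W = ⊥
  -- For the zero subspace any unit vector serves.
  · refine ⟨![1, 0, 0], by simp [dotProduct, Fin.sum_univ_three], fun c hc => ⟨0, ?_⟩⟩
    rw [h, Submodule.mem_bot] at hc
    simp [hc]
  · obtain ⟨a, ha, ha0⟩ := W.ne_bot_iff.mp h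
    have hpos : 0 < a ⬝ᵥ a := lt_of_le_of_ne (by simpa using dotProduct_star_self_nonneg a)
      (fun e => ha0 (dotProduct_self_eq_zero.mp e.symm))
    set n := √(a ⬝ᵥ a) with hn
    have hn2 : n * n = a ⬝ᵥ a := Real.mul_self_sqrt hpos.le
    have hn0 : n ≠ 0 := (Real.sqrt_pos.mpr hpos).ne'
    refine ⟨n⁻¹ • a, ?_, fun c hc => ⟨(a ⬝ᵥ c) / n, ?_⟩⟩
    · rw [smul_dotProduct, dotProduct_smul, smul_eq_mul, smul_eq_mul, ← hn2]
      field_simp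
    · have h1 : a ⨯₃ (a ⨯₃ c) = 0 := by rw [hW a ha c hc]; simp
      have h2 : (a ⬝ᵥ a) • c = (a ⬝ᵥ c) • a := by
        have : a ⨯₃ (a ⨯₃ c) = (a ⬝ᵥ c) • a - (a ⬝ᵥ a) • c := by
          ext i
          fin_cases i <;> simp [dotProduct, cross_apply, Fin.sum_univ_three] <;> ring
        rw [h1] at this
        exact (sub_eq_zero.mp this.symm).symm
      rw [← hn2] at h2
      rw [smul_smul, ← div_eq_mul_inv, div_div]
      calc c = (n * n)⁻¹ • ((n * n) • c) := (inv_smul_smul₀ (mul_ne_zero hn0 hn0) c).symm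
        _ = _ := by rw [h2, smul_smul, div_eq_inv_mul]

theorem eq_of_two_le_finrank {W : Submodule ℝ (V3 × V3)} {a b : V3}
    (h2 : 2 ≤ Module.finrank ℝ W)
    (h : ∀ p ∈ W, ∃ s t : ℝ, p = (s • a, t • b)) : (a, 0) ∈ W ∧ (0, b) ∈ W := by
  classical
  set s : Finset (V3 × V3) := {(a, 0), (0, b)} with hs
  have hle : W ≤ Submodule.span ℝ (s : Set (V3 × V3)) := by
    intro p hp
    obtain ⟨x, y, rfl⟩ := h p hp
    have e : ((x • a, y • b) : V3 × V3) = x • (a, 0) + y • (0, b) := by simp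
    rw [e]
    exact Submodule.add_mem _ (Submodule.smul_mem _ _ (Submodule.subset_span (by simp [hs])))
      (Submodule.smul_mem _ _ (Submodule.subset_span (by simp [hs])))
  have hcard : Module.finrank ℝ (Submodule.span ℝ (s : Set (V3 × V3))) ≤ 2 :=
    (finrank_span_finset_le_card s).trans Finset.card_le_two
  have := Submodule.eq_of_le_of_finrank_le hle (hcard.trans h2)
  rw [this]
  exact ⟨Submodule.subset_span (by simp [hs]), Submodule.subset_span (by simp [hs])⟩

theorem trace_quat_projection (a b c d : V3) (α γ : ℝ) :
    ((α • (1 : M4) + quatL a * quatR b) * (γ • (1 : M4) + quatL c * quatR d)).trace =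
      4 * (α * γ + (a ⬝ᵥ c) * (b ⬝ᵥ d)) := by
  have h : (quatL a * quatR b * (quatL c * quatR d)).trace = 4 * ((a ⬝ᵥ c) * (b ⬝ᵥ d)) := by
    have e : quatL a * quatR b * (quatL c * quatR d) =
        (quatL a * quatL c) * (quatR b * quatR d) := by
      simp only [mul_assoc]
      rw [← mul_assoc (quatR b), quatR_mul_quatL, mul_assoc]
    rw [e]
    simp [Matrix.trace, quatL, quatR, Fin.sum_univ_four, dotProduct, Fin.sum_univ_three]
    ring
  simp only [mul_add, add_mul, smul_mul_assoc, one_mul, mul_smul_comm, mul_one, trace_add,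
    trace_smul, trace_quatL_mul_quatR, h, trace_one, Fintype.card_fin, smul_eq_mul]
  push_cast
  ring

/-- For unit a and b, L_a R_b is an involution and L_a + R_b = L_a(1 − L_a R_b). Hence 1 + L_a R_b
is twice the projection onto the kernel of L_a + R_b; the statement is the homogeneous version. -/
theorem quatLR_mul_projection {a b : V3} (h : a ⬝ᵥ a = b ⬝ᵥ b) :
    quatLR (a, b) * ((a ⬝ᵥ a) • (1 : M4) + quatL a * quatR b) = 0 := by
  have h1 : quatL a * (quatL a * quatR b) = -(a ⬝ᵥ a) • quatR b := by
    rw [← mul_assoc, quatL_mul_self, smul_mul_assoc, one_mul]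
  have h2 : quatR b * (quatL a * quatR b) = -(a ⬝ᵥ a) • quatL a := by
    rw [← mul_assoc, quatR_mul_quatL, mul_assoc, quatR_mul_self, mul_smul_comm, mul_one, h]
  rw [quatLR_apply, mul_add, add_mul, add_mul, h1, h2]
  simp only [mul_smul_comm, mul_one]
  module

/-- Orthogonal imaginary quaternions anticommute, and the signs from the left and right factors
cancel. -/
theorem quat_projection_comm {a b c d : V3} (hac : a ⬝ᵥ c = 0) (hbd : b ⬝ᵥ d = 0) (α γ : ℝ) :
    (α • (1 : M4) + quatL a * quatR b) * (γ • (1 : M4) + quatL c * quatR d) =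
      (γ • (1 : M4) + quatL c * quatR d) * (α • (1 : M4) + quatL a * quatR b) := by
  have e : ∀ a b c d : V3, quatL a * quatR b * (quatL c * quatR d) =
      (quatL a * quatL c) * (quatR b * quatR d) := fun a b c d => by
    simp only [mul_assoc]
    rw [← mul_assoc (quatR b), quatR_mul_quatL, mul_assoc]
  have h : quatL c * quatR d * (quatL a * quatR b) = quatL a * quatR b * (quatL c * quatR d) := by
    rw [e, e, quatL_mul_comm a c, quatR_mul_comm b d, hac, hbd]
    simp
  simp only [mul_add, add_mul, smul_mul_assoc, one_mul, mul_smul_comm, mul_one, h]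
  module

variable {𝔤 : Submodule ℝ M4}

/-- A non-commutative Lie algebra of pairs of imaginary quaternions, in which the two components
of every bracket have equal length, has a common kernel vector. -/
theorem exists_common_kernel {W : Submodule ℝ (V3 × V3)}
    (hbr : ∀ a b c d : V3, (a, b) ∈ W → (c, d) ∈ W → (a ⨯₃ c, -(b ⨯₃ d)) ∈ W)
    (hnorm : ∀ a b c d : V3, (a, b) ∈ W → (c, d) ∈ W →
      (a ⨯₃ c) ⬝ᵥ (a ⨯₃ c) = (b ⨯₃ d) ⬝ᵥ (b ⨯₃ d))
    {a b c d : V3} (hab : (a, b) ∈ W) (hcd : (c, d) ∈ W) (hac : a ⨯₃ c ≠ 0) :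
    ∃ w : Fin 4 → ℝ, w ≠ 0 ∧ ∀ p ∈ W, quatLR p *ᵥ w = 0 := by
  -- Apply the norm equality to (p, q) and its bracket with (r, s): |p × (p × r)|² = |p|²|p × r|²,
  -- likewise on the other side, and the factor |p × r|² = |q × s|² cancels.
  have hn : ∀ p q r s : V3, (p, q) ∈ W → (r, s) ∈ W → p ⨯₃ r ≠ 0 → p ⬝ᵥ p = q ⬝ᵥ q := by
    intro p q r s hpq hrs hne
    have h1 := hnorm _ _ _ _ hpq (hbr _ _ _ _ hpq hrs)
    have h2 := hnorm _ _ _ _ hpq hrs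
    have h3 := cross_dotProduct_self_add p (p ⨯₃ r)
    have h4 := cross_dotProduct_self_add q (q ⨯₃ s)
    rw [dot_self_cross] at h3 h4
    simp only [map_neg, neg_dotProduct, dotProduct_neg, neg_neg] at h1
    have h5 : (p ⨯₃ r) ⬝ᵥ (p ⨯₃ r) ≠ 0 := fun h => hne (dotProduct_self_eq_zero.mp h)
    apply mul_right_cancel₀ h5
    rw [← h3, h1]
    rw [h2, ← h4]
  -- orthogonalise the two generators
  have hA := hn _ _ _ _ hab hcd hac
  have hC := hn _ _ _ _ hcd hab (by rwa [← cross_anticomm, neg_ne_zero])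
  -- Polarisation: equal lengths for the sum of the generators give equal inner products.
  have hS := hn _ _ _ _ (W.add_mem hab hcd) hcd (by simpa using hac)
  have hdot : a ⬝ᵥ c = b ⬝ᵥ d := by
    simp only [add_dotProduct, dotProduct_add, dotProduct_comm c a, dotProduct_comm d b] at hS
    linarith
  obtain ⟨c', d', hcd', hac', hoc, hod⟩ : ∃ c' d' : V3, (c', d') ∈ W ∧ a ⨯₃ c' ≠ 0 ∧
      a ⬝ᵥ c' = 0 ∧ b ⬝ᵥ d' = 0 := by
    have ha0 : a ⬝ᵥ a ≠ 0 := fun h => hac (by rw [dotProduct_self_eq_zero.mp h]; simp)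
    refine ⟨(a ⬝ᵥ a) • c - (a ⬝ᵥ c) • a, (a ⬝ᵥ a) • d - (a ⬝ᵥ c) • b,
      W.sub_mem (W.smul_mem (a ⬝ᵥ a) hcd) (W.smul_mem (a ⬝ᵥ c) hab), ?_, ?_, ?_⟩
    · simpa [ha0] using hac
    · simp only [dotProduct_sub, dotProduct_smul, smul_eq_mul]; ring
    · simp only [dotProduct_sub, dotProduct_smul, smul_eq_mul, hA, hdot]; ring
  have hC' := hn _ _ _ _ hcd' hab (by rwa [← cross_anticomm, neg_ne_zero])
  have hbd' : b ⨯₃ d' ≠ 0 := fun h => by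
    have := hnorm _ _ _ _ hab hcd'
    rw [h, dotProduct_zero] at this
    exact hac' (dotProduct_self_eq_zero.mp this)
  -- The two factors are multiples of commuting projections onto the kernels of the generators, so
  -- the image of P lies in both kernels. P is nonzero because its trace is 4|a|²|c'|².
  set P := ((a ⬝ᵥ a) • (1 : M4) + quatL a * quatR b) *
    ((c' ⬝ᵥ c') • (1 : M4) + quatL c' * quatR d') with hP
  have hP0 : P ≠ 0 := fun h => by
    have h1 := trace_quat_projection a b c' d' (a ⬝ᵥ a) (c' ⬝ᵥ c')
    rw [← hP, h, trace_zero, hoc, zero_mul, add_zero] at h1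
    have h2 := cross_dotProduct_self_add a c'
    rw [hoc] at h2
    apply hac'
    apply dotProduct_self_eq_zero.mp
    linarith
  obtain ⟨z, hz⟩ : ∃ z, P *ᵥ z ≠ 0 := by
    by_contra! hcon
    exact hP0 (Matrix.ext_of_mulVec_single fun i => by rw [hcon, zero_mulVec])
  have k1 : quatLR (a, b) *ᵥ (P *ᵥ z) = 0 := by
    rw [mulVec_mulVec, hP, ← mul_assoc, quatLR_mul_projection hA, zero_mul, zero_mulVec]
  have k2 : quatLR (c', d') *ᵥ (P *ᵥ z) = 0 := by
    rw [mulVec_mulVec, hP, quat_projection_comm hoc hod, ← mul_assoc,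
      quatLR_mul_projection hC', zero_mul, zero_mulVec]
  have k3 : quatLR (a ⨯₃ c', -(b ⨯₃ d')) *ᵥ (P *ᵥ z) = 0 := by
    have := congrArg (· *ᵥ (P *ᵥ z)) (quatLR_bracket a b c' d')
    simp only [sub_mulVec, ← mulVec_mulVec, k1, k2, mulVec_zero, sub_zero, smul_mulVec] at this
    simpa using this.symm
  refine ⟨P *ᵥ z, hz, ?_⟩
  rintro ⟨p, q⟩ hpq
  have hdec := cross_dotProduct_self_smul a c' p
  set m := (a ⨯₃ c') ⬝ᵥ (a ⨯₃ c') with hm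
  have hm0 : m ≠ 0 := fun h => hac' (dotProduct_self_eq_zero.mp h)
  set x := (c' ⬝ᵥ c') * (p ⬝ᵥ a) - (a ⬝ᵥ c') * (p ⬝ᵥ c')
  set y := (a ⬝ᵥ a) * (p ⬝ᵥ c') - (a ⬝ᵥ c') * (p ⬝ᵥ a)
  set t := p ⬝ᵥ a ⨯₃ c'
  -- Subtracting the expansion of p leaves an element with first component 0. By the norm equality
  -- its second component has zero cross product with b and d', hence vanishes; so the two
  -- generators and their bracket span W.
  have hmem : ((0 : V3), m • q - (x • b + y • d' + t • -(b ⨯₃ d'))) ∈ W := by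
    have := W.sub_mem (W.smul_mem m hpq) (W.add_mem (W.add_mem (W.smul_mem x hab)
      (W.smul_mem y hcd')) (W.smul_mem t (hbr _ _ _ _ hab hcd')))
    convert this using 1
    simp only [Prod.smul_mk, Prod.mk_add_mk, Prod.mk_sub_mk, hdec, sub_self]
  have hq : m • q = x • b + y • d' + t • -(b ⨯₃ d') := by
    apply sub_eq_zero.mp
    refine eq_zero_of_cross_eq_zero (b := b) (d := d') ?_ ?_ hbd'
    · have := hnorm _ _ _ _ hmem hab
      apply dotProduct_self_eq_zero.mp
      rw [← this]; simp
    · have := hnorm _ _ _ _ hmem hcd'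
      apply dotProduct_self_eq_zero.mp
      rw [← this]; simp
  have hLR : m • quatLR (p, q) = x • quatLR (a, b) + y • quatLR (c', d') +
      t • quatLR (a ⨯₃ c', -(b ⨯₃ d')) := by
    simp only [← map_smul, ← map_add, Prod.smul_mk, Prod.mk_add_mk, hdec, hq]
  have := congrArg (· *ᵥ (P *ᵥ z)) hLR
  simp only [add_mulVec, smul_mulVec, k1, k2, k3, smul_zero, add_zero] at this
  exact (smul_eq_zero.mp this).resolve_left hm0

/-- A Lie algebra of skew-symmetric `4 × 4` matrices of dimension at least two that acts nowhere
locally transitively on the sphere is a maximal torus or has a fixed vector. -/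
theorem torus_or_common_kernel (hskew : ∀ X ∈ 𝔤, Xᵀ = -X)
    (hbr : ∀ X ∈ 𝔤, ∀ Y ∈ 𝔤, X * Y - Y * X ∈ 𝔤) (hrank : 2 ≤ Module.finrank ℝ 𝔤)
    (hdet : ∀ X ∈ 𝔤, ∀ Y ∈ 𝔤, ∀ Z ∈ 𝔤, ∀ v : Fin 4 → ℝ,
      det (of ![v, X *ᵥ v, Y *ᵥ v, Z *ᵥ v]) = 0) :
    (∃ a b : V3, a ⬝ᵥ a = 1 ∧ b ⬝ᵥ b = 1 ∧ quatL a ∈ 𝔤 ∧ quatR b ∈ 𝔤 ∧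
      ∀ X ∈ 𝔤, ∃ s t : ℝ, X = s • quatL a + t • quatR b) ∨
    ∃ w : Fin 4 → ℝ, w ≠ 0 ∧ ∀ X ∈ 𝔤, X *ᵥ w = 0 := by
  set W := 𝔤.comap quatLR with hW
  have hmap : W.map quatLR = 𝔤 := by
    refine Submodule.map_comap_eq_of_le fun X hX => ?_
    obtain ⟨p, rfl⟩ := exists_quatLR_of_skew (hskew X hX)
    exact ⟨p, rfl⟩
  have hWrank : 2 ≤ Module.finrank ℝ W := by
    rw [← hmap] at hrank
    exact hrank.trans (Submodule.finrank_map_le _ _)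
  have hWbr : ∀ a b c d : V3, (a, b) ∈ W → (c, d) ∈ W → (a ⨯₃ c, -(b ⨯₃ d)) ∈ W := by
    intro a b c d h1 h2
    have := hbr _ h1 _ h2
    rw [quatLR_bracket] at this
    exact (𝔤.smul_mem_iff two_ne_zero).mp this
  -- With the bracket as third element, the summed determinant is 4(|a × c|² − |b × d|²).
  have hnorm : ∀ a b c d : V3, (a, b) ∈ W → (c, d) ∈ W →
      (a ⨯₃ c) ⬝ᵥ (a ⨯₃ c) = (b ⨯₃ d) ⬝ᵥ (b ⨯₃ d) := by
    intro a b c d h1 h2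
    have h := sum_det_rows_quatLR a b c d (a ⨯₃ c) (-(b ⨯₃ d))
    rw [Finset.sum_eq_zero fun i _ => hdet _ h1 _ h2 _ (hWbr _ _ _ _ h1 h2) _] at h
    have e : ∀ a c : V3, a ⬝ᵥ c ⨯₃ (a ⨯₃ c) = (a ⨯₃ c) ⬝ᵥ (a ⨯₃ c) := fun a c => by
      rw [triple_product_permutation, triple_product_permutation]
    rw [map_neg, dotProduct_neg, e, e] at h
    linarith
  by_cases hcomm : ∃ a b c d : V3, (a, b) ∈ W ∧ (c, d) ∈ W ∧ a ⨯₃ c ≠ 0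
  · right
    obtain ⟨a, b, c, d, hab, hcd, hac⟩ := hcomm
    obtain ⟨w, hw, h⟩ := exists_common_kernel hWbr hnorm hab hcd hac
    refine ⟨w, hw, fun X hX => ?_⟩
    rw [← hmap] at hX
    obtain ⟨p, hp, rfl⟩ := hX
    exact h p hp
  · left
    push Not at hcomm
    obtain ⟨a, ha, ha'⟩ := exists_unit_le_span (W.map (LinearMap.fst ℝ V3 V3)) (by
      rintro _ ⟨⟨a, b⟩, h1, rfl⟩ _ ⟨⟨c, d⟩, h2, rfl⟩
      exact hcomm a b c d h1 h2)
    obtain ⟨b, hb, hb'⟩ := exists_unit_le_span (W.map (LinearMap.snd ℝ V3 V3)) (by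
      rintro _ ⟨⟨a, b⟩, h1, rfl⟩ _ ⟨⟨c, d⟩, h2, rfl⟩
      have := hnorm a b c d h1 h2
      rw [hcomm a b c d h1 h2, dotProduct_zero] at this
      exact dotProduct_self_eq_zero.mp this.symm)
    have hpar : ∀ p ∈ W, ∃ s t : ℝ, p = (s • a, t • b) := fun p hp => by
      obtain ⟨s, hs⟩ := ha' _ ⟨p, hp, rfl⟩
      obtain ⟨t, ht⟩ := hb' _ ⟨p, hp, rfl⟩
      exact ⟨s, t, Prod.ext hs ht⟩
    obtain ⟨h1, h2⟩ := eq_of_two_le_finrank hWrank hpar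
    have h1' : quatLR (a, 0) ∈ 𝔤 := h1
    have h2' : quatLR (0, b) ∈ 𝔤 := h2
    rw [quatLR_apply, quatR_zero, add_zero] at h1'
    rw [quatLR_apply, quatL_zero, zero_add] at h2'
    refine ⟨a, b, ha, hb, h1', h2', fun X hX => ?_⟩
    rw [← hmap] at hX
    obtain ⟨p, hp, rfl⟩ := hX
    obtain ⟨s, t, rfl⟩ := hpar p hp
    refine ⟨s, t, ?_⟩
    have e : ((s • a, t • b) : V3 × V3) = s • (a, 0) + t • (0, b) := by simp
    rw [e, map_add, map_smul, map_smul, quatLR_apply, quatLR_apply, quatL_zero, quatR_zero,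
      add_zero, zero_add]

end SkewLieAlgebras
end

/-! ### Orbit spaces with a geodesic section. -/

noncomputable section

section Sections

open MeasureTheory Topology Matrix

local notation "E4" => EuclideanSpace ℝ (Fin 4)

/-- The point of the three-sphere given by a unit vector. -/
def S3.ofVec (v : Fin 4 → ℝ) (hv : v ⬝ᵥ v = 1) : S3 :=
  ⟨WithLp.toLp 2 v, by
    rw [mem_sphere_zero_iff_norm, EuclideanSpace.norm_eq, Real.sqrt_eq_one, ← hv]
    simp [dotProduct, sq]⟩

theorem S3.dotProduct_self (x : S3) : x.1.ofLp ⬝ᵥ x.1.ofLp = 1 := by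
  have h : inner ℝ x.1 x.1 = (1 : ℝ) := by
    rw [real_inner_self_eq_norm_sq, S3.norm_eq]; norm_num
  rwa [EuclideanSpace.inner_eq_star_dotProduct, star_trivial] at h

theorem S3.coe_smul_ofLp (A : O4) (x : S3) :
    ((A • x : S3) : E4).ofLp = A.1 *ᵥ x.1.ofLp := rfl

theorem S3.ext_ofLp {x y : S3} (h : x.1.ofLp = y.1.ofLp) : x = y :=
  Subtype.ext (WithLp.ofLp_injective 2 h)

theorem S3.cos_geodist (x y : S3) :
    Real.cos (S3.geodist x y) = x.1.ofLp ⬝ᵥ y.1.ofLp := by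
  rw [← S3.inner_eq_cos_geodist, EuclideanSpace.inner_eq_star_dotProduct, star_trivial,
    dotProduct_comm]

theorem S3.le_geodist {x y : S3} {c : ℝ} (h0 : c ≤ Real.pi)
    (h : x.1.ofLp ⬝ᵥ y.1.ofLp ≤ Real.cos c) : c ≤ S3.geodist x y := by
  rw [← S3.cos_geodist] at h
  by_contra hlt
  exact absurd h (not_le.mpr
    (Real.cos_lt_cos_of_nonneg_of_le_pi (S3.geodist_nonneg x y) h0 (not_le.mp hlt)))

theorem S3.geodist_eq {x y : S3} {c : ℝ} (h0 : 0 ≤ c) (h1 : c ≤ Real.pi)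
    (h : x.1.ofLp ⬝ᵥ y.1.ofLp = Real.cos c) : S3.geodist x y = c := by
  rw [← S3.cos_geodist] at h
  exact Real.injOn_cos ⟨S3.geodist_nonneg x y, S3.geodist_le_pi x y⟩ ⟨h0, h1⟩ h

/-- A geodesic that meets every orbit and minimises distances between orbits identifies the
orbit space with an interval. -/
theorem orbitSpace_eq_interval (G : ClosedSubgroup O4) {ℓ : ℝ} (hℓ : 0 < ℓ) (hℓπ : ℓ ≤ Real.pi)
    (σ : ℝ → S3)
    (hgeo : ∀ s t, (σ s).1.ofLp ⬝ᵥ (σ t).1.ofLp = Real.cos (s - t))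
    (hmin : ∀ s ∈ Set.Icc 0 ℓ, ∀ t ∈ Set.Icc 0 ℓ, ∀ g ∈ G.toSubgroup,
      (σ s).1.ofLp ⬝ᵥ (g.1 *ᵥ (σ t).1.ofLp) ≤ Real.cos (s - t))
    (hsurj : ∀ x : S3, ∃ t ∈ Set.Icc 0 ℓ, ∃ g ∈ G.toSubgroup, g • x = σ t) :
    orbitSpaceDim G = 1 ∧ orbitSpaceDiam G = ℓ := by
  let f : Set.Icc 0 ℓ → OrbitSpace G := fun t => OrbitSpace.mk G (σ t)
  have hf : Isometry f := by
    refine Isometry.of_dist_eq fun s t => ?_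
    obtain ⟨s, hs⟩ := s
    obtain ⟨t, ht⟩ := t
    have hst : |s - t| ≤ Real.pi := by
      rw [abs_le]; constructor <;> linarith [hs.1, hs.2, ht.1, ht.2]
    rw [Subtype.dist_eq, Real.dist_eq]
    refine le_antisymm ?_ ?_
    · refine (OrbitSpace.dist_mk_le G _ _).trans_eq (S3.geodist_eq (abs_nonneg _) hst ?_)
      rw [hgeo, Real.cos_abs]
    · refine le_ciInf fun g => S3.le_geodist hst ?_
      rw [Real.cos_abs]
      exact hmin s hs t ht g g.2
  have hr : Set.range f = Set.univ := by
    rw [Set.range_eq_univ]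
    intro q
    obtain ⟨x, rfl⟩ := OrbitSpace.mk_surjective G q
    obtain ⟨t, ht, g, hg, h⟩ := hsurj x
    refine ⟨⟨t, ht⟩, Quotient.sound ⟨⟨g, hg⟩, h⟩⟩
  constructor
  · rw [orbitSpaceDim, ← hr, ← Set.image_univ, hf.dimH_image]
    have h1 := (isometry_subtype_coe (s := Set.Icc 0 ℓ)).dimH_image Set.univ
    rw [Set.image_univ, Subtype.range_coe_subtype, Set.ofPred_mem_eq] at h1
    rw [← h1, Real.dimH_of_nonempty_interior]
    · simp
    · rw [interior_Icc]; exact Set.nonempty_Ioo.mpr hℓ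
  · rw [orbitSpaceDiam, ← hr, hf.diam_range]
    have h1 := (isometry_subtype_coe (s := Set.Icc 0 ℓ)).diam_range
    rw [← h1, Subtype.range_coe_subtype, Set.ofPred_mem_eq, Real.diam_Icc hℓ.le, sub_zero]

end Sections
end

/-! ### The Lie algebra of G and the bound on its dimension. -/

noncomputable section

section MatrixLieAlgebra

open Matrix Topology
open scoped Matrix.Norms.L2Operator

local notation "E4" => EuclideanSpace ℝ (Fin 4)
local notation "M4" => Matrix (Fin 4) (Fin 4) ℝ

variable (G : ClosedSubgroup O4)

/-- The matrices of a subgroup of `O(4)`. -/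
def matrixSubmonoid : Submonoid M4 :=
  G.toSubgroup.toSubmonoid.map (Submonoid.subtype _)

theorem isCompact_matrixSubmonoid : IsCompact (matrixSubmonoid G : Set M4) :=
  G.isClosed'.isCompact.image continuous_subtype_val

theorem isClosed_matrixSubmonoid : IsClosed (matrixSubmonoid G : Set M4) :=
  (isCompact_matrixSubmonoid G).isClosed

theorem O4.transpose_mul (g : O4) : g.1ᵀ * g.1 = 1 := (Unitary.mem_iff.mp g.2).1

theorem O4.mul_transpose (g : O4) : g.1 * g.1ᵀ = 1 := (Unitary.mem_iff.mp g.2).2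

theorem invClosed_matrixSubmonoid : (matrixSubmonoid G).InvClosed := by
  rintro _ b ⟨g, hg, rfl⟩ hb
  refine ⟨g⁻¹, G.toSubgroup.inv_mem hg, ?_⟩
  have h1 : g.1ᵀ * (g.1 * b) = g.1ᵀ := by
    have : g.1 * b = 1 := hb
    rw [this, mul_one]
  rw [← mul_assoc, O4.transpose_mul, one_mul] at h1
  exact h1.symm

/-- The Lie algebra of a closed subgroup of `O(4)`. -/
def matrixLieAlg : Submodule ℝ M4 :=
  lieAlg (matrixSubmonoid G) (isClosed_matrixSubmonoid G) (invClosed_matrixSubmonoid G)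

variable {G}

theorem exp_mem_of_mem_matrixLieAlg {X : M4} (hX : X ∈ matrixLieAlg G) (t : ℝ) :
    ∃ g ∈ G.toSubgroup, g.1 = NormedSpace.exp (t • X) := hX t

/-- Differentiate exp(tX)ᵀ exp(tX) = 1 at t = 0. -/
theorem transpose_of_mem_matrixLieAlg {X : M4} (hX : X ∈ matrixLieAlg G) : Xᵀ = -X := by
  have h : HasDerivAt (fun t : ℝ => NormedSpace.exp (t • Xᵀ) * NormedSpace.exp (t • X))
      (Xᵀ + X) 0 := by
    have := (hasDerivAt_exp_smul_zero Xᵀ).fun_mul (hasDerivAt_exp_smul_zero X)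
    simpa using this
  have hc : (fun t : ℝ => NormedSpace.exp (t • Xᵀ) * NormedSpace.exp (t • X)) = fun _ => 1 := by
    funext t
    obtain ⟨g, -, hg⟩ := exp_mem_of_mem_matrixLieAlg hX t
    rw [← transpose_smul, exp_transpose, ← hg, O4.transpose_mul]
  rw [hc] at h
  exact eq_neg_of_add_eq_zero_left (h.unique (hasDerivAt_const _ _))

theorem conj_mem_matrixLieAlg {X : M4} (hX : X ∈ matrixLieAlg G) {g : O4}
    (hg : g ∈ G.toSubgroup) : g.1 * X * g.1ᵀ ∈ matrixLieAlg G :=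
  conj_mem_lieAlg _ _ ⟨g, hg, rfl⟩ g.mul_transpose g.transpose_mul hX

theorem norm_exp_le_one {X : M4} (hX : X ∈ matrixLieAlg G) (t : ℝ) :
    ‖NormedSpace.exp (t • X)‖ ≤ 1 := by
  obtain ⟨g, -, hg⟩ := exp_mem_of_mem_matrixLieAlg hX t
  rw [← hg]
  exact (CStarRing.norm_of_mem_unitary g.2).le

theorem norm_exp_sub_one_le {X : M4} (hX : X ∈ matrixLieAlg G) (hX1 : ‖X‖ ≤ 1) {s : ℝ}
    (hs : 0 ≤ s) : ‖NormedSpace.exp (s • X) - 1‖ ≤ s := by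
  have := norm_image_sub_le_of_norm_deriv_le_segment' (a := 0) (b := s) (C := 1)
    (f := fun t : ℝ => NormedSpace.exp (t • X)) (f' := fun t => NormedSpace.exp (t • X) * X)
    (fun t _ => (hasDerivAt_exp_smul_const (𝕂 := ℝ) X t).hasDerivWithinAt)
    (fun t _ => (norm_mul_le _ _).trans
      (mul_le_one₀ (norm_exp_le_one hX t) (norm_nonneg _) hX1)) s ⟨hs, le_rfl⟩
  simpa using this

theorem norm_toEuclideanCLM_sub_le (g : O4) (A : M4) (hA : ‖A‖ ≤ 1) {B : M4} {s : ℝ}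
    (hB : ‖B - 1‖ ≤ s) (x : S3) :
    ‖toEuclideanCLM (n := Fin 4) (𝕜 := ℝ) (g.1 * (A * B)) x.1 -
      toEuclideanCLM (n := Fin 4) (𝕜 := ℝ) (g.1 * A) x.1‖ ≤ s := by
  have e : toEuclideanCLM (n := Fin 4) (𝕜 := ℝ) (g.1 * (A * B)) x.1 -
      toEuclideanCLM (n := Fin 4) (𝕜 := ℝ) (g.1 * A) x.1 =
      toEuclideanCLM (n := Fin 4) (𝕜 := ℝ) (g.1 * (A * (B - 1))) x.1 := by
    rw [← _root_.sub_apply, ← map_sub]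
    congr 2
    noncomm_ring
  rw [e]
  refine (ContinuousLinearMap.le_opNorm _ _).trans ?_
  rw [S3.norm_eq, mul_one, ← cstar_norm_def]
  refine (norm_mul_le _ _).trans ?_
  rw [CStarRing.norm_of_mem_unitary g.2, one_mul]
  refine (norm_mul_le _ _).trans ?_
  exact (mul_le_of_le_one_left (norm_nonneg _) hA).trans hB

/-- Compactness of G, applied to translates of the neighbourhood of 1 from the closed subgroup
theorem. -/
theorem exists_finite_cosets : ∃ t : Finset M4, (∀ A ∈ t, A ∈ matrixSubmonoid G) ∧
    ∀ g ∈ G.toSubgroup, ∃ A ∈ t, ∃ Y ∈ matrixLieAlg G, ‖Y‖ ≤ 1 ∧ g.1 = A * NormedSpace.exp Y := by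
  have hev := eventually_mem_exp_lieAlg (isClosed_matrixSubmonoid G) (invClosed_matrixSubmonoid G)
  obtain ⟨t, ht, hcov⟩ := (isCompact_matrixSubmonoid G).elim_nhds_subcover
    (fun A => {B | Aᵀ * B ∈ matrixSubmonoid G → ∃ Y ∈ matrixLieAlg G, ‖Y‖ ≤ 1 ∧
      NormedSpace.exp Y = Aᵀ * B}) (by
        rintro _ ⟨g, hg, rfl⟩
        have hc : Continuous fun B : M4 => g.1ᵀ * B := by fun_prop
        exact (hc.tendsto' _ _ g.transpose_mul).eventually hev)
  refine ⟨t, ht, fun h hh => ?_⟩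
  have hm : h.1 ∈ (matrixSubmonoid G : Set M4) := ⟨h, hh, rfl⟩
  have := hcov hm
  simp only [Set.mem_iUnion] at this
  obtain ⟨A, hA, hAh⟩ := this
  obtain ⟨g, hg, rfl⟩ := ht A hA
  obtain ⟨Y, hY, hY1, hYe⟩ := hAh ⟨g⁻¹ * h, G.toSubgroup.mul_mem (G.toSubgroup.inv_mem hg) hh, rfl⟩
  refine ⟨_, hA, Y, hY, hY1, ?_⟩
  rw [hYe]
  change h.1 = g.1 * (g.1ᵀ * h.1)
  rw [← mul_assoc, O4.mul_transpose, one_mul]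

/-- If dim 𝔤 ≤ 1, G lies in finitely many arcs A·exp(cX) with |c| ≤ 1. Their images of a point are
curves of speed at most 1, so sampling c at step r gives an r-net of each orbit with O(1/r) points.
-/
theorem two_le_finrank_matrixLieAlg (h : orbitSpaceDim G = 1) :
    2 ≤ Module.finrank ℝ (matrixLieAlg G) := by
  classical
  by_contra hlt
  obtain ⟨⟨X₀, hX₀⟩, hX₀s⟩ := finrank_le_one_iff.mp (by omega : Module.finrank ℝ (matrixLieAlg G) ≤ 1)
  obtain ⟨X, hX, hX1, hXs⟩ : ∃ X ∈ matrixLieAlg G, ‖X‖ ≤ 1 ∧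
      ∀ Y ∈ matrixLieAlg G, ‖Y‖ ≤ 1 → ∃ c : ℝ, |c| ≤ 1 ∧ Y = c • X := by
    by_cases h0 : X₀ = 0
    · refine ⟨0, Submodule.zero_mem _, by simp, fun Y hY _ => ⟨0, by simp, ?_⟩⟩
      obtain ⟨c, hc⟩ := hX₀s ⟨Y, hY⟩
      have := congrArg Subtype.val hc
      simpa [h0] using this.symm
    · have hn : ‖X₀‖ ≠ 0 := norm_ne_zero_iff.mpr h0
      refine ⟨‖X₀‖⁻¹ • X₀, Submodule.smul_mem _ _ hX₀, by rw [norm_smul]; simp [hn],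
        fun Y hY hY1 => ?_⟩
      obtain ⟨c, hc⟩ := hX₀s ⟨Y, hY⟩
      have hc' : c • X₀ = Y := congrArg Subtype.val hc
      refine ⟨c * ‖X₀‖, ?_, ?_⟩
      · rw [← hc', norm_smul, Real.norm_eq_abs] at hY1
        rwa [abs_mul, abs_norm]
      · rw [smul_smul, mul_assoc, mul_inv_cancel₀ hn, mul_one, hc']
  obtain ⟨t, htS, ht⟩ := exists_finite_cosets (G := G)
  -- Each arc uses the 2n + 1 parameters rj with |j| ≤ n = ⌈1/r⌉. Since r ≤ 1, n ≤ 2/r and 2n + 1 ≤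
  -- 5/r.
  have h2 := two_le_orbitSpaceDim G (5 * t.card) (fun x r hr hr1 => by
    set n : ℕ := ⌈1 / r⌉₊ with hn
    refine ⟨(t ×ˢ Finset.Icc (-(n : ℤ)) n).image fun p =>
      toEuclideanCLM (n := Fin 4) (𝕜 := ℝ) (p.1 * NormedSpace.exp ((r * p.2) • X)) x.1, ?_, ?_⟩
    · have h1 : (n : ℝ) ≤ 2 / r := by
        have := (Nat.ceil_lt_add_one (by positivity : 0 ≤ 1 / r)).le
        have h1r : 1 ≤ 1 / r := by rw [le_div_iff₀ hr]; simpa using hr1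
        have e : 2 / r = 1 / r + 1 / r := by ring
        rw [e]; linarith
      have h3 : (2 * n + 1 : ℝ) ≤ 5 / r := by
        have h1r : 1 ≤ 1 / r := by rw [le_div_iff₀ hr]; simpa using hr1
        have e : 5 / r = 2 * (2 / r) + 1 / r := by ring
        rw [e]; linarith
      refine (Nat.cast_le.mpr Finset.card_image_le).trans ?_
      rw [Finset.card_product, Int.card_Icc]
      have e : ((n : ℤ) + 1 - -(n : ℤ)).toNat = 2 * n + 1 := by omega
      rw [e]
      push_cast
      calc (t.card : ℝ) * (2 * n + 1) ≤ t.card * (5 / r) := by gcongr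
        _ = 5 * t.card / r := by ring
    · intro g hg
      obtain ⟨A, hA, Y, hY, hY1, hgA⟩ := ht g hg
      obtain ⟨c, hc, rfl⟩ := hXs Y hY hY1
      obtain ⟨k, -, rfl⟩ := htS A hA
      set j := ⌊c / r⌋ with hj
      have hj1 : (j : ℝ) * r ≤ c := (le_div_iff₀ hr).mp (Int.floor_le _)
      have hj2 : c < (j + 1) * r := (div_lt_iff₀ hr).mp (Int.lt_floor_add_one _)
      have hnr : 1 / r ≤ n := Nat.le_ceil _
      have hcr : |c / r| ≤ n := by
        rw [abs_div, abs_of_pos hr]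
        exact (div_le_div_of_nonneg_right hc hr.le).trans hnr
      rw [abs_le] at hcr
      have hmem : j ∈ Finset.Icc (-(n : ℤ)) n := by
        rw [Finset.mem_Icc]
        constructor
        · rw [hj, Int.le_floor]; push_cast; exact hcr.1
        · have : (j : ℝ) ≤ n := (Int.floor_le _).trans hcr.2
          exact_mod_cast this
      refine ⟨_, Finset.mem_image.mpr ⟨(_, j), Finset.mem_product.mpr ⟨hA, hmem⟩, rfl⟩, ?_⟩
      have hsplit : NormedSpace.exp (c • X) =
          NormedSpace.exp ((r * j) • X) * NormedSpace.exp ((c - r * j) • X) := by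
        rw [← NormedSpace.exp_add_of_commute_of_real, ← add_smul, add_sub_cancel]
        exact ((Commute.refl X).smul_left _).smul_right _
      rw [O4.coe_smul, hgA, hsplit]
      refine norm_toEuclideanCLM_sub_le k _ (norm_exp_le_one hX _)
        ((norm_exp_sub_one_le hX hX1 (by linarith)).trans (by linarith)) x)
  rw [h] at h2
  norm_num at h2

end MatrixLieAlgebra
end

/-! ### The lower bound on the diameter. -/

noncomputable section

section LowerBound

open Matrix Topology
open scoped Matrix.Norms.L2Operator

local notation "M4" => Matrix (Fin 4) (Fin 4) ℝ

variable {G : ClosedSubgroup O4}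

/-- By homogeneity the orbit is open; it is closed as a fibre of the quotient map. The sphere is
connected, so the quotient is a point. -/
theorem orbitSpaceDim_eq_zero_of_mem_nhds (x : S3)
    (h : {z : S3 | ∃ g ∈ G.toSubgroup, g • x = z} ∈ 𝓝 x) : orbitSpaceDim G = 0 := by
  have hcont : ∀ g : O4, Continuous fun z : S3 => g • z := fun g =>
    Continuous.subtype_mk ((toEuclideanCLM (n := Fin 4) (𝕜 := ℝ) g.1).continuous.comp
      continuous_subtype_val) _
  set O := {z : S3 | ∃ g ∈ G.toSubgroup, g • x = z} with hO
  have hOeq : O = OrbitSpace.mk G ⁻¹' {OrbitSpace.mk G x} := by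
    ext z
    constructor
    · rintro ⟨g, hg, rfl⟩
      exact Quotient.sound ⟨⟨g, hg⟩, rfl⟩
    · intro hz
      obtain ⟨g, hg⟩ := Quotient.exact hz
      exact ⟨g, g.2, hg⟩
  have hopen : IsOpen O := by
    rw [isOpen_iff_mem_nhds]
    rintro _ ⟨g, hg, rfl⟩
    have h1 : (fun z : S3 => g⁻¹ • z) ⁻¹' O ∈ 𝓝 (g • x) :=
      (hcont g⁻¹).continuousAt.preimage_mem_nhds (by rwa [inv_smul_smul])
    filter_upwards [h1] with z hz
    obtain ⟨k, hk, hkz⟩ := hz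
    exact ⟨g * k, G.toSubgroup.mul_mem hg hk, by rw [mul_smul, hkz, smul_inv_smul]⟩
  have hclosed : IsClosed O := by
    rw [hOeq]
    exact isClosed_singleton.preimage (OrbitSpace.continuous_mk G)
  have : PreconnectedSpace S3 := Subtype.preconnectedSpace (isPreconnected_sphere (by
    rw [← Module.finrank_eq_rank, finrank_euclideanSpace, Fintype.card_fin]; norm_num) _ _)
  have huniv : O = Set.univ := IsClopen.eq_univ ⟨hclosed, hopen⟩ ⟨x, mem_of_mem_nhds h⟩
  refine Set.Subsingleton.dimH_zero ?_
  have key : ∀ z, OrbitSpace.mk G z = OrbitSpace.mk G x := fun z => by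
    have : z ∈ O := by rw [huniv]; trivial
    rwa [hOeq] at this
  intro p _ q _
  obtain ⟨y, rfl⟩ := OrbitSpace.mk_surjective G p
  obtain ⟨z, rfl⟩ := OrbitSpace.mk_surjective G q
  rw [key y, key z]

theorem O4.dotProduct_mulVec (g : O4) (v w : Fin 4 → ℝ) : (g.1 *ᵥ v) ⬝ᵥ (g.1 *ᵥ w) = v ⬝ᵥ w := by
  rw [Matrix.dotProduct_mulVec, ← mulVec_transpose, mulVec_mulVec, g.transpose_mul, one_mulVec]

theorem exp_smul_one_add (s : ℝ) (Z : M4) :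
    NormedSpace.exp (s • (1 : M4) + Z) = Real.exp s • NormedSpace.exp Z := by
  rw [NormedSpace.exp_add_of_commute_of_real ((Commute.one_left Z).smul_left s)]
  have : NormedSpace.exp (s • (1 : M4)) = Real.exp s • 1 := by
    rw [← Algebra.algebraMap_eq_smul_one, ← Algebra.algebraMap_eq_smul_one,
      ← NormedSpace.algebraMap_exp_comm, Real.exp_eq_exp_ℝ]
  rw [this, smul_mul_assoc, one_mul]

/-- Adjoining the scalar direction to X, Y, Z gives a map ℝ⁴ → ℝ⁴ with surjective derivative at 0,
avoiding charts on the sphere. Its value is e^{t₀} times a point of the orbit, so unit values lie in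
the orbit itself. -/
theorem orbitSpaceDim_eq_zero_of_det {X Y Z : M4} (hX : X ∈ matrixLieAlg G)
    (hY : Y ∈ matrixLieAlg G) (hZ : Z ∈ matrixLieAlg G) (x : S3)
    (hdet : det (of ![x.1.ofLp, X *ᵥ x.1.ofLp, Y *ᵥ x.1.ofLp, Z *ᵥ x.1.ofLp]) ≠ 0) :
    orbitSpaceDim G = 0 := by
  set v := x.1.ofLp with hv
  let T : (Fin 4 → ℝ) →ₗ[ℝ] M4 := Fintype.linearCombination ℝ ![1, X, Y, Z]
  let ev : M4 →ₗ[ℝ] (Fin 4 → ℝ) := (mulVecBilin ℝ ℝ).flip v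
  have hT : ∀ t, T t = t 0 • (1 : M4) + (t 1 • X + t 2 • Y + t 3 • Z) := fun t => by
    simp [T, Fintype.linearCombination_apply, Fin.sum_univ_four, add_assoc]
  have hev : ∀ A, ev A = A *ᵥ v := fun A => rfl
  let F : (Fin 4 → ℝ) → (Fin 4 → ℝ) := fun t => NormedSpace.exp (T t) *ᵥ v
  have hexp : HasStrictFDerivAt (NormedSpace.exp : M4 → M4) (ContinuousLinearMap.id ℝ M4)
    (T.toContinuousLinearMap 0) := by
    rw [map_zero]; exact hasStrictFDerivAt_exp_zero (𝕂 := ℝ) (𝔸 := M4)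
  have hF : HasStrictFDerivAt F (ev.toContinuousLinearMap.comp T.toContinuousLinearMap) 0 := by
    have h1 := HasStrictFDerivAt.comp (0 : Fin 4 → ℝ) hexp
      T.toContinuousLinearMap.hasStrictFDerivAt
    have h2 := HasStrictFDerivAt.comp (0 : Fin 4 → ℝ)
      ev.toContinuousLinearMap.hasStrictFDerivAt h1
    exact h2
  have hsurj : (ev.toContinuousLinearMap.comp T.toContinuousLinearMap).range = ⊤ := by
    rw [eq_top_iff]
    intro w _
    set A : M4 := of ![v, X *ᵥ v, Y *ᵥ v, Z *ᵥ v] with hA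
    have hAu : IsUnit Aᵀ.det := by rw [det_transpose]; exact isUnit_iff_ne_zero.mpr hdet
    refine ⟨Aᵀ⁻¹ *ᵥ w, ?_⟩
    have h1 : ∀ t, ev (T t) = Aᵀ *ᵥ t := fun t => by
      rw [hev, hT, add_mulVec, add_mulVec, add_mulVec, smul_mulVec, smul_mulVec, smul_mulVec,
        smul_mulVec, one_mulVec]
      ext i
      simp [A, mulVec_transpose, vecMul, dotProduct, Fin.sum_univ_four]
      ring
    change ev (T _) = w
    rw [h1, mulVec_mulVec, mul_nonsing_inv _ hAu, one_mulVec]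
  have hmap := hF.map_nhds_eq_of_surj hsurj
  have hF0 : F 0 = v := by simp [F]
  rw [hF0] at hmap
  have hev : ∀ᶠ y in 𝓝 v, y ⬝ᵥ y = 1 → ∃ g ∈ G.toSubgroup, g.1 *ᵥ v = y := by
    rw [← hmap, Filter.eventually_map]
    refine Filter.Eventually.of_forall fun t ht => ?_
    have hmem : t 1 • X + t 2 • Y + t 3 • Z ∈ matrixLieAlg G :=
      Submodule.add_mem _ (Submodule.add_mem _ (Submodule.smul_mem _ _ hX)
        (Submodule.smul_mem _ _ hY)) (Submodule.smul_mem _ _ hZ)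
    obtain ⟨g, hg, hge⟩ := exp_mem_of_mem_matrixLieAlg hmem 1
    rw [one_smul] at hge
    have hFt : F t = Real.exp (t 0) • (g.1 *ᵥ v) := by
      simp only [F]
      rw [hT, exp_smul_one_add, hge, smul_mulVec]
    rw [hFt, smul_dotProduct, dotProduct_smul, g.dotProduct_mulVec, hv, S3.dotProduct_self] at ht
    have h1 : Real.exp (t 0) = 1 := by
      simp only [smul_eq_mul, mul_one] at ht
      nlinarith [Real.exp_pos (t 0)]
    exact ⟨g, hg, by rw [hFt, h1, one_smul]⟩
  refine orbitSpaceDim_eq_zero_of_mem_nhds x ?_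
  have hc : Continuous fun z : S3 => z.1.ofLp :=
    (PiLp.continuous_ofLp 2 _).comp continuous_subtype_val
  filter_upwards [hc.continuousAt.eventually hev] with z hz
  obtain ⟨g, hg, hgz⟩ := hz z.dotProduct_self
  exact ⟨g, hg, S3.ext_ofLp hgz⟩

theorem exists_smul_ofVec {v : Fin 4 → ℝ} (hv : v ≠ 0) :
    ∃ c : ℝ, c ≠ 0 ∧ (c • v) ⬝ᵥ (c • v) = 1 := by
  have h0 : v ⬝ᵥ v ≠ 0 := fun h => hv (dotProduct_self_eq_zero.mp h)
  have hpos : 0 < v ⬝ᵥ v :=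
    lt_of_le_of_ne (by simpa using dotProduct_star_self_nonneg v) h0.symm
  have hs := Real.mul_self_sqrt hpos.le
  have hs0 := (Real.sqrt_pos.mpr hpos).ne'
  refine ⟨(√(v ⬝ᵥ v))⁻¹, inv_ne_zero hs0, ?_⟩
  rw [smul_dotProduct, dotProduct_smul, smul_eq_mul, smul_eq_mul]
  nth_rewrite 3 [← hs]
  field_simp

theorem det_eq_zero_of_mem_matrixLieAlg (h : orbitSpaceDim G ≠ 0) {X Y Z : M4}
    (hX : X ∈ matrixLieAlg G) (hY : Y ∈ matrixLieAlg G) (hZ : Z ∈ matrixLieAlg G)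
    (v : Fin 4 → ℝ) : det (of ![v, X *ᵥ v, Y *ᵥ v, Z *ᵥ v]) = 0 := by
  by_contra hne
  have hv : v ≠ 0 := by
    rintro rfl
    exact hne (det_eq_zero_of_row_eq_zero 0 fun j => by simp)
  obtain ⟨c, hc, hcv⟩ := exists_smul_ofVec hv
  refine h (orbitSpaceDim_eq_zero_of_det hX hY hZ (S3.ofVec (c • v) hcv) ?_)
  have e : of ![c • v, X *ᵥ (c • v), Y *ᵥ (c • v), Z *ᵥ (c • v)] =
      c • of ![v, X *ᵥ v, Y *ᵥ v, Z *ᵥ v] := by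
    ext i j
    fin_cases i <;> simp [mulVec_smul]
  change det (of ![c • v, X *ᵥ (c • v), Y *ᵥ (c • v), Z *ᵥ (c • v)]) ≠ 0
  rw [e, det_smul]
  exact mul_ne_zero (pow_ne_zero _ hc) hne

/-- If the Lie algebra of `G` is nonzero and has a fixed vector, then the orbit space has
diameter at least `π / 2`. -/
theorem pi_div_two_le_diam_of_common_kernel {X : M4} (hX : X ∈ matrixLieAlg G) (hX0 : X ≠ 0)
    {w : Fin 4 → ℝ} (hw : w ≠ 0) (hker : ∀ Y ∈ matrixLieAlg G, Y *ᵥ w = 0) :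
    Real.pi / 2 ≤ orbitSpaceDiam G := by
  obtain ⟨z, hz⟩ : ∃ z, X *ᵥ z ≠ 0 := by
    by_contra! hcon
    exact hX0 (Matrix.ext_of_mulVec_single fun i => by rw [hcon, zero_mulVec])
  obtain ⟨c, -, hc⟩ := exists_smul_ofVec hz
  obtain ⟨d, -, hd⟩ := exists_smul_ofVec hw
  refine le_orbitSpaceDiam G (S3.ofVec _ hc) (S3.ofVec _ hd) _ fun g hg =>
    S3.le_geodist (by linarith [Real.pi_pos]) ?_
  -- The conjugate g⁻¹Xg lies in 𝔤, so it kills w. Since X is skew, its image is then orthogonal to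
  -- gw.
  have hXg : X *ᵥ (g.1 *ᵥ w) = 0 := by
    have h1 := hker _ (conj_mem_matrixLieAlg hX (G.toSubgroup.inv_mem hg))
    have h2 : (g⁻¹).1 = g.1ᵀ := rfl
    rw [h2, transpose_transpose, ← mulVec_mulVec, ← mulVec_mulVec] at h1
    have := congrArg (g.1 *ᵥ ·) h1
    simp only [mulVec_zero] at this
    rwa [mulVec_mulVec, g.mul_transpose, one_mulVec] at this
  rw [S3.coe_smul_ofLp, Real.cos_pi_div_two]
  change (c • X *ᵥ z) ⬝ᵥ (g.1 *ᵥ (d • w)) ≤ 0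
  rw [mulVec_smul, smul_dotProduct, dotProduct_smul, dotProduct_comm, dotProduct_mulVec,
    ← mulVec_transpose, transpose_of_mem_matrixLieAlg hX, neg_mulVec, hXg]
  simp

theorem dotProduct_eq_zero_of_mulVec_eq {D : M4} (hD : Dᵀ = D) {u v : Fin 4 → ℝ}
    (hu : D *ᵥ u = u) (hv : D *ᵥ v = -v) : u ⬝ᵥ v = 0 := by
  have : (D *ᵥ u) ⬝ᵥ v = u ⬝ᵥ (D *ᵥ v) := by
    rw [dotProduct_mulVec, ← mulVec_transpose, hD]
  rw [hu, hv, dotProduct_neg] at this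
  linarith

/-- The matrix 1 + εD has trace 4, hence is nonzero, and its image consists of ε-eigenvectors. -/
theorem exists_unit_eigenvector {D : M4} (hD2 : D * D = 1) (htr : D.trace = 0) {ε : ℝ}
    (hε : ε * ε = 1) : ∃ u : Fin 4 → ℝ, u ⬝ᵥ u = 1 ∧ D *ᵥ u = ε • u := by
  have h0 : (1 : M4) + ε • D ≠ 0 := fun h => by
    have := congrArg trace h
    simp [htr] at this
  obtain ⟨z, hz⟩ : ∃ z, ((1 : M4) + ε • D) *ᵥ z ≠ 0 := by
    by_contra! hcon
    exact h0 (Matrix.ext_of_mulVec_single fun i => by rw [hcon, zero_mulVec])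
  obtain ⟨c, -, hc⟩ := exists_smul_ofVec hz
  refine ⟨_, hc, ?_⟩
  rw [mulVec_smul, mulVec_mulVec, smul_comm, ← smul_mulVec ε]
  congr 2
  rw [mul_add, mul_one, mul_smul_comm, hD2, smul_add, smul_smul, hε, one_smul, add_comm]

/-- If `G` preserves up to sign a traceless orthogonal involution, then the orbit space has
diameter at least `π / 4`. -/
theorem pi_div_four_le_diam_of_involution {D : M4} (hD : Dᵀ = D) (hD2 : D * D = 1)
    (htr : D.trace = 0)
    (hG : ∀ g ∈ G.toSubgroup, g.1 * D * g.1ᵀ = D ∨ g.1 * D * g.1ᵀ = -D) :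
    Real.pi / 4 ≤ orbitSpaceDiam G := by
  obtain ⟨u, hu1, hu⟩ := exists_unit_eigenvector hD2 htr (ε := 1) (by norm_num)
  obtain ⟨u', hu1', hu'⟩ := exists_unit_eigenvector hD2 htr (ε := -1) (by norm_num)
  rw [one_smul] at hu
  rw [neg_one_smul] at hu'
  have huu' := dotProduct_eq_zero_of_mulVec_eq hD hu hu'
  have hs : (√2 / 2) * (√2 / 2) = (1 / 2 : ℝ) := by
    have := Real.mul_self_sqrt (show (0 : ℝ) ≤ 2 by norm_num)
    linarith
  have hy : ((√2 / 2) • (u + u')) ⬝ᵥ ((√2 / 2) • (u + u')) = 1 := by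
    simp only [smul_dotProduct, dotProduct_smul, add_dotProduct, dotProduct_add, hu1, hu1', huu',
      dotProduct_comm u' u, smul_eq_mul]
    linarith
  have hle : ∀ (a v : Fin 4 → ℝ), a ⬝ᵥ a = 1 → v ⬝ᵥ v = 1 → a ⬝ᵥ v ≤ 1 := by
    intro a v ha hv
    have h1 : 0 ≤ (a - v) ⬝ᵥ (a - v) := by simpa using dotProduct_star_self_nonneg (a - v)
    simp only [sub_dotProduct, dotProduct_sub, ha, hv, dotProduct_comm v a] at h1
    linarith
  refine le_orbitSpaceDiam G (S3.ofVec _ hy) (S3.ofVec u hu1) _ fun g hg =>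
    S3.le_geodist (by linarith [Real.pi_pos]) ?_
  rw [S3.coe_smul_ofLp, Real.cos_pi_div_four]
  change ((√2 / 2) • (u + u')) ⬝ᵥ (g.1 *ᵥ u) ≤ √2 / 2
  set v := g.1 *ᵥ u with hv
  have hv1 : v ⬝ᵥ v = 1 := by rw [hv, g.dotProduct_mulVec, hu1]
  have hDg : (g.1 * D * g.1ᵀ) *ᵥ v = v := by
    rw [hv, mulVec_mulVec, mul_assoc, g.transpose_mul, mul_one, ← mulVec_mulVec, hu]
  -- The vector v = gu lies in one eigenspace of D, so it is orthogonal to u or to u', and only one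
  -- term survives.
  have hsum : (u + u') ⬝ᵥ v ≤ 1 := by
    rw [add_dotProduct]
    rcases hG g hg with h | h
    · rw [h] at hDg
      have h1 := dotProduct_eq_zero_of_mulVec_eq hD hDg hu'
      rw [dotProduct_comm u' v, h1, add_zero]
      exact hle u v hu1 hv1
    · rw [h, neg_mulVec] at hDg
      have h1 := dotProduct_eq_zero_of_mulVec_eq hD hu (neg_eq_iff_eq_neg.mp hDg)
      rw [h1, zero_add]
      exact hle u' v hu1' hv1
  rw [smul_dotProduct, smul_eq_mul]
  have hs0 : 0 ≤ √2 / 2 := by positivity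
  nlinarith

theorem quat_involution_sq {a b : Fin 3 → ℝ} (ha : a ⬝ᵥ a = 1) (hb : b ⬝ᵥ b = 1) :
    quatL a * quatR b * (quatL a * quatR b) = 1 := by
  have : quatL a * quatR b * (quatL a * quatR b) =
      (quatL a * quatL a) * (quatR b * quatR b) := by
    simp only [mul_assoc]
    rw [← mul_assoc (quatR b), quatR_mul_quatL, mul_assoc]
  rw [this, quatL_mul_self, quatR_mul_self, ha, hb]
  simp

/-- Multiplying the two conjugates gives a combination of 1 and D = L_a R_b. The trace kills the
scalar term, and squaring to 1 leaves the coefficient ±1. -/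
theorem conj_quat_involution {a b : Fin 3 → ℝ} (ha : a ⬝ᵥ a = 1) (hb : b ⬝ᵥ b = 1) (g : O4)
    {s t p q : ℝ} (hL : g.1 * quatL a * g.1ᵀ = s • quatL a + t • quatR b)
    (hR : g.1 * quatR b * g.1ᵀ = p • quatL a + q • quatR b) :
    g.1 * (quatL a * quatR b) * g.1ᵀ = quatL a * quatR b ∨
      g.1 * (quatL a * quatR b) * g.1ᵀ = -(quatL a * quatR b) := by
  set D := quatL a * quatR b with hD
  have htrD : D.trace = 0 := trace_quatL_mul_quatR a b
  have hD2 : D * D = 1 := quat_involution_sq ha hb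
  have hprod : g.1 * D * g.1ᵀ = (g.1 * quatL a * g.1ᵀ) * (g.1 * quatR b * g.1ᵀ) := by
    simp only [hD, mul_assoc]
    rw [← mul_assoc g.1ᵀ g.1, g.transpose_mul, one_mul]
  have hform : g.1 * D * g.1ᵀ = (-(s * p + t * q)) • (1 : M4) + (s * q + t * p) • D := by
    rw [hprod, hL, hR]
    simp only [add_mul, mul_add, smul_mul_assoc, mul_smul_comm, quatL_mul_self, quatR_mul_self,
      quatR_mul_quatL, ha, hb, ← hD]
    module
  have htr : (g.1 * D * g.1ᵀ).trace = 0 := by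
    rw [trace_mul_comm, ← mul_assoc, g.transpose_mul, one_mul, htrD]
  have hspt : s * p + t * q = 0 := by
    rw [hform, trace_add, trace_smul, trace_smul, htrD, trace_one] at htr
    simp at htr
    linarith
  rw [hspt, neg_zero, zero_smul, zero_add] at hform
  set κ := s * q + t * p
  have hsq : (g.1 * D * g.1ᵀ) * (g.1 * D * g.1ᵀ) = 1 := by
    have : (g.1 * D * g.1ᵀ) * (g.1 * D * g.1ᵀ) = g.1 * (D * (g.1ᵀ * g.1) * D) * g.1ᵀ := by
      simp only [mul_assoc]
    rw [this, g.transpose_mul, mul_one, hD2, mul_one, g.mul_transpose]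
  rw [hform, smul_mul_smul_comm, hD2] at hsq
  have hκ : κ * κ = 1 := by
    have := congrFun (congrFun hsq 0) 0
    simpa using this
  rcases mul_self_eq_one_iff.mp hκ with h | h
  · left; rw [hform, h, one_smul]
  · right; rw [hform, h, neg_one_smul]

/-- A one-dimensional orbit space of the three-sphere has diameter at least `π / 4`. -/
theorem pi_div_four_le_orbitSpaceDiam (h : orbitSpaceDim G = 1) :
    Real.pi / 4 ≤ orbitSpaceDiam G := by
  have hrank := two_le_finrank_matrixLieAlg h
  rcases torus_or_common_kernel (𝔤 := matrixLieAlg G)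
    (fun X hX => transpose_of_mem_matrixLieAlg hX)
    (fun X hX Y hY => bracket_mem_lieAlg _ _ hX hY) hrank
    (fun X hX Y hY Z hZ v => det_eq_zero_of_mem_matrixLieAlg (by rw [h]; exact one_ne_zero)
      hX hY hZ v) with ⟨a, b, ha, hb, hLa, hRb, hspan⟩ | ⟨w, hw, hker⟩
  · refine pi_div_four_le_diam_of_involution (D := quatL a * quatR b) ?_
      (quat_involution_sq ha hb) (trace_quatL_mul_quatR a b) fun g hg => ?_
    · rw [transpose_mul, transpose_quatL, transpose_quatR, neg_mul_neg, quatR_mul_quatL]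
    · obtain ⟨s, t, hst⟩ := hspan _ (conj_mem_matrixLieAlg hLa hg)
      obtain ⟨p, q, hpq⟩ := hspan _ (conj_mem_matrixLieAlg hRb hg)
      exact conj_quat_involution ha hb g hst hpq
  · obtain ⟨X, hX, hX0⟩ : ∃ X ∈ matrixLieAlg G, X ≠ 0 := by
      by_contra! hcon
      have : matrixLieAlg G = ⊥ := (Submodule.eq_bot_iff _).mpr hcon
      rw [this, finrank_bot] at hrank
      omega
    have := pi_div_two_le_diam_of_common_kernel hX hX0 hw hker
    linarith [Real.pi_pos]

end LowerBound
end

/-! ### The two examples: the torus with swap, and SO(3) with reflection. -/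

noncomputable section

section Examples

open Matrix Topology

local notation "M4" => Matrix (Fin 4) (Fin 4) ℝ

theorem exists_polar (x y : ℝ) :
    ∃ a : ℝ, x = √(x ^ 2 + y ^ 2) * Real.cos a ∧ y = √(x ^ 2 + y ^ 2) * Real.sin a := by
  have h : ‖(⟨x, y⟩ : ℂ)‖ = √(x ^ 2 + y ^ 2) := by
    rw [Complex.norm_def, Complex.normSq_mk]; ring_nf
  refine ⟨Complex.arg ⟨x, y⟩, ?_, ?_⟩
  · rw [← h, Complex.norm_mul_cos_arg]
  · rw [← h, Complex.norm_mul_sin_arg]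

theorem exists_cos_sin_eq {r s : ℝ} (hr : 0 ≤ r) (hs : 0 ≤ s) (h : r ^ 2 + s ^ 2 = 1) :
    ∃ t ∈ Set.Icc 0 (Real.pi / 2), Real.cos t = r ∧ Real.sin t = s := by
  have hs1 : s ≤ 1 := by nlinarith
  refine ⟨Real.arcsin s, ⟨Real.arcsin_nonneg.mpr hs, Real.arcsin_le_pi_div_two s⟩, ?_,
    Real.sin_arcsin (by linarith) hs1⟩
  rw [Real.cos_arcsin, ← h, add_sub_cancel_right, Real.sqrt_sq hr]

theorem weylSwap_mul_torusMatrix (a b : ℝ) :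
    weylSwap.1 * torusMatrix a b = torusMatrix b a * weylSwap.1 := by
  ext i j
  fin_cases i <;> fin_cases j <;>
    simp [weylSwap, torusMatrix, Matrix.mul_apply, Fin.sum_univ_four]

theorem weylSwap_mul_self : weylSwap.1 * weylSwap.1 = 1 := by
  ext i j
  fin_cases i <;> fin_cases j <;> simp [weylSwap, Matrix.mul_apply, Fin.sum_univ_four]

theorem star_weylSwap : star weylSwap.1 = weylSwap.1 := by
  ext i j
  fin_cases i <;> fin_cases j <;> simp [weylSwap, Matrix.star_apply]

/-- The extension of the maximal torus by the exchange of its two factors. -/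
def torusSwapGroup : Subgroup O4 where
  carrier := {A | ∃ a b : ℝ, A.1 = torusMatrix a b ∨ A.1 = torusMatrix a b * weylSwap.1}
  one_mem' := ⟨0, 0, Or.inl torusMatrix_zero.symm⟩
  mul_mem' := by
    rintro A B ⟨a, b, hA⟩ ⟨c, d, hB⟩
    have hAB : (A * B).1 = A.1 * B.1 := rfl
    rcases hA with hA | hA <;> rcases hB with hB | hB
    · exact ⟨a + c, b + d, Or.inl (by rw [hAB, hA, hB, torusMatrix_mul])⟩
    · exact ⟨a + c, b + d, Or.inr (by rw [hAB, hA, hB, ← mul_assoc, torusMatrix_mul])⟩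
    · refine ⟨a + d, b + c, Or.inr ?_⟩
      rw [hAB, hA, hB, mul_assoc, weylSwap_mul_torusMatrix, ← mul_assoc, torusMatrix_mul]
    · refine ⟨a + d, b + c, Or.inl ?_⟩
      rw [hAB, hA, hB, mul_assoc, ← mul_assoc weylSwap.1, weylSwap_mul_torusMatrix,
        mul_assoc (torusMatrix d c), weylSwap_mul_self, mul_one, torusMatrix_mul]
  inv_mem' := by
    rintro A ⟨a, b, hA⟩
    have hAi : (A⁻¹).1 = star A.1 := rfl
    rcases hA with hA | hA
    · exact ⟨-a, -b, Or.inl (by rw [hAi, hA, torusMatrix_star])⟩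
    · refine ⟨-b, -a, Or.inr ?_⟩
      rw [hAi, hA, star_mul, star_weylSwap, torusMatrix_star, weylSwap_mul_torusMatrix]

theorem torusSwapGroup_eq : torusSwapGroup = torusT2 ⊔ Subgroup.zpowers weylSwap := by
  apply le_antisymm
  · have hw : weylSwap ∈ torusT2 ⊔ Subgroup.zpowers weylSwap :=
      (le_sup_right : Subgroup.zpowers weylSwap ≤ _) (Subgroup.mem_zpowers _)
    have hT : torusT2 ≤ torusT2 ⊔ Subgroup.zpowers weylSwap := le_sup_left
    rintro A ⟨a, b, hA | hA⟩
    · exact hT ⟨a, b, hA⟩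
    · have h1 : A * weylSwap ∈ torusT2 := ⟨a, b, by
        change A.1 * weylSwap.1 = _
        rw [hA, mul_assoc, weylSwap_mul_self, mul_one]⟩
      have := Subgroup.mul_mem _ (hT h1) (Subgroup.inv_mem _ hw)
      rwa [mul_inv_cancel_right] at this
  · rw [sup_le_iff, Subgroup.zpowers_le]
    exact ⟨fun A ⟨a, b, hA⟩ => ⟨a, b, Or.inl hA⟩,
      0, 0, Or.inr (by rw [torusMatrix_zero, one_mul])⟩

/-- The range is a continuous image of the compact space `Circle × Circle`. -/
theorem isClosed_range_torusMatrix :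
    IsClosed (Set.range fun p : ℝ × ℝ => torusMatrix p.1 p.2) := by
  let f : Circle × Circle → M4 := fun p =>
    !![(p.1 : ℂ).re, (p.1 : ℂ).im, 0, 0; -(p.1 : ℂ).im, (p.1 : ℂ).re, 0, 0;
      0, 0, (p.2 : ℂ).re, (p.2 : ℂ).im; 0, 0, -(p.2 : ℂ).im, (p.2 : ℂ).re]
  have hf : Continuous f := by
    refine continuous_matrix fun i j => ?_
    fin_cases i <;> fin_cases j <;> simp [f] <;> fun_prop
  have hexp : ∀ a b : ℝ, f (Circle.exp a, Circle.exp b) = torusMatrix a b := fun a b => by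
    simp [f, torusMatrix, Circle.coe_exp, Complex.exp_ofReal_mul_I_re,
      Complex.exp_ofReal_mul_I_im]
  have : (Set.range fun p : ℝ × ℝ => torusMatrix p.1 p.2) = Set.range f := by
    ext A
    constructor
    · rintro ⟨⟨a, b⟩, rfl⟩
      exact ⟨_, hexp a b⟩
    · rintro ⟨⟨z, w⟩, rfl⟩
      refine ⟨(Complex.arg z, Complex.arg w), ?_⟩
      refine (hexp _ _).symm.trans ?_
      rw [Circle.exp_arg, Circle.exp_arg]
  rw [this]
  exact (isCompact_range hf).isClosed

theorem isClosed_torusSwapGroup : IsClosed (torusSwapGroup : Set O4) := by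
  have h1 : Continuous fun A : O4 => A.1 := continuous_subtype_val
  have h2 : Continuous fun A : O4 => A.1 * weylSwap.1 := h1.mul continuous_const
  have : (torusSwapGroup : Set O4) =
      (fun A : O4 => A.1) ⁻¹' (Set.range fun p : ℝ × ℝ => torusMatrix p.1 p.2) ∪
      (fun A : O4 => A.1 * weylSwap.1) ⁻¹' (Set.range fun p : ℝ × ℝ => torusMatrix p.1 p.2) := by
    ext A
    constructor
    · rintro ⟨a, b, hA | hA⟩
      · exact Or.inl ⟨(a, b), hA.symm⟩
      · refine Or.inr ⟨(a, b), ?_⟩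
        change _ = A.1 * weylSwap.1
        rw [hA, mul_assoc, weylSwap_mul_self, mul_one]
    · rintro (⟨⟨a, b⟩, hA⟩ | ⟨⟨a, b⟩, hA⟩)
      · exact ⟨a, b, Or.inl hA.symm⟩
      · refine ⟨a, b, Or.inr ?_⟩
        change torusMatrix a b = A.1 * weylSwap.1 at hA
        rw [hA, mul_assoc, weylSwap_mul_self, mul_one]
  rw [this]
  exact (isClosed_range_torusMatrix.preimage h1).union (isClosed_range_torusMatrix.preimage h2)

theorem torusMatrix_mulVec (a b p q : ℝ) :
    torusMatrix a b *ᵥ ![p, 0, q, 0] =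
      ![p * Real.cos a, -(p * Real.sin a), q * Real.cos b, -(q * Real.sin b)] := by
  ext i
  fin_cases i <;> simp [torusMatrix, mulVec, dotProduct, Fin.sum_univ_four] <;> ring

theorem weylSwap_mulVec (v : Fin 4 → ℝ) : weylSwap.1 *ᵥ v = ![v 2, v 3, v 0, v 1] := by
  ext i
  fin_cases i <;> simp [weylSwap, mulVec, dotProduct, Fin.sum_univ_four]

/-- The orbit space of the torus extended by the exchange of its factors is an interval of
length `π / 4`. -/
theorem orbitSpace_torusSwapGroup (G : ClosedSubgroup O4) (hG : G.toSubgroup = torusSwapGroup) :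
    orbitSpaceDim G = 1 ∧ orbitSpaceDiam G = Real.pi / 4 := by
  have hπ := Real.pi_pos
  refine orbitSpace_eq_interval G (by positivity) (by linarith)
    (fun t => S3.ofVec ![Real.cos t, 0, Real.sin t, 0] (by
      simp [dotProduct, Fin.sum_univ_four, ← sq])) ?_ ?_ ?_
  · intro s t
    simp [S3.ofVec, dotProduct, Fin.sum_univ_four, Real.cos_sub]
  · intro s hs t ht g hg
    rw [hG] at hg
    have hcs : 0 ≤ Real.cos s := Real.cos_nonneg_of_mem_Icc ⟨by linarith [hs.1], by linarith [hs.2]⟩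
    have hct : 0 ≤ Real.cos t := Real.cos_nonneg_of_mem_Icc ⟨by linarith [ht.1], by linarith [ht.2]⟩
    have hss : 0 ≤ Real.sin s := Real.sin_nonneg_of_nonneg_of_le_pi hs.1 (by linarith [hs.2])
    have hst : 0 ≤ Real.sin t := Real.sin_nonneg_of_nonneg_of_le_pi ht.1 (by linarith [ht.2])
    obtain ⟨a, b, hg | hg⟩ := hg
    · have e : (![Real.cos s, 0, Real.sin s, 0] : Fin 4 → ℝ) ⬝ᵥ
          (g.1 *ᵥ ![Real.cos t, 0, Real.sin t, 0]) =
          (Real.cos s * Real.cos t) * Real.cos a + (Real.sin s * Real.sin t) * Real.cos b := by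
        rw [hg, torusMatrix_mulVec]
        simp [dotProduct, Fin.sum_univ_four]; ring
      refine e.trans_le ?_
      rw [Real.cos_sub]
      exact add_le_add (mul_le_of_le_one_right (mul_nonneg hcs hct) (Real.cos_le_one a))
        (mul_le_of_le_one_right (mul_nonneg hss hst) (Real.cos_le_one b))
    · have e : (![Real.cos s, 0, Real.sin s, 0] : Fin 4 → ℝ) ⬝ᵥ
          (g.1 *ᵥ ![Real.cos t, 0, Real.sin t, 0]) =
          (Real.cos s * Real.sin t) * Real.cos a + (Real.sin s * Real.cos t) * Real.cos b := by
        have e1 : weylSwap.1 *ᵥ ![Real.cos t, 0, Real.sin t, 0] =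
            ![Real.sin t, 0, Real.cos t, 0] := by
          rw [weylSwap_mulVec]; simp
        rw [hg, ← mulVec_mulVec, e1, torusMatrix_mulVec]
        simp [dotProduct, Fin.sum_univ_four]; ring
      refine e.trans_le ?_
      calc (Real.cos s * Real.sin t) * Real.cos a + (Real.sin s * Real.cos t) * Real.cos b
          ≤ Real.cos s * Real.sin t + Real.sin s * Real.cos t :=
            add_le_add (mul_le_of_le_one_right (mul_nonneg hcs hst) (Real.cos_le_one a))
              (mul_le_of_le_one_right (mul_nonneg hss hct) (Real.cos_le_one b))
        _ = Real.cos (Real.pi / 2 - (s + t)) := by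
            rw [Real.cos_pi_div_two_sub, Real.sin_add]; ring
        -- Here s, t ≤ π/4 is essential: it gives |s − t| ≤ π/2 − (s + t).
        _ ≤ Real.cos |s - t| := by
            refine Real.cos_le_cos_of_nonneg_of_le_pi (abs_nonneg _)
              (by linarith [hs.1, ht.1]) ?_
            rw [abs_le]
            constructor <;> linarith [hs.2, ht.2]
        _ = Real.cos (s - t) := Real.cos_abs _
  · intro x
    set v := x.1.ofLp with hv
    obtain ⟨a, ha0, ha1⟩ := exists_polar (v 0) (v 1)
    obtain ⟨b, hb0, hb1⟩ := exists_polar (v 2) (v 3)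
    set r := √(v 0 ^ 2 + v 1 ^ 2) with hr
    set s := √(v 2 ^ 2 + v 3 ^ 2) with hs
    have hr0 : 0 ≤ r := Real.sqrt_nonneg _
    have hs0 : 0 ≤ s := Real.sqrt_nonneg _
    have hrs : r ^ 2 + s ^ 2 = 1 := by
      rw [hr, hs, Real.sq_sqrt (by positivity), Real.sq_sqrt (by positivity), ← x.dotProduct_self]
      simp [dotProduct, Fin.sum_univ_four, ← hv]; ring
    have hT : torusMatrix a b *ᵥ v = ![r, 0, s, 0] := by
      ext i
      fin_cases i <;> simp [torusMatrix, mulVec, dotProduct, Fin.sum_univ_four]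
      · rw [ha0, ha1]; linear_combination r * Real.cos_sq_add_sin_sq a
      · rw [ha0, ha1]; ring
      · rw [hb0, hb1]; linear_combination s * Real.cos_sq_add_sin_sq b
      · rw [hb0, hb1]; ring
    have horth : ∀ p q : ℝ, torusMatrix p q ∈ Matrix.orthogonalGroup (Fin 4) ℝ := fun p q => by
      refine Matrix.mem_unitaryGroup_iff.mpr ?_
      rw [torusMatrix_star, torusMatrix_mul]
      simp [torusMatrix_zero]
    have hle : ∀ t ∈ Set.Icc 0 (Real.pi / 2), Real.sin t ≤ Real.cos t → t ≤ Real.pi / 4 := by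
      intro t ht hsc
      by_contra! hlt
      have h1 := Real.sin_lt_sin_of_lt_of_le_pi_div_two (by linarith) ht.2 hlt
      have h2 := Real.cos_lt_cos_of_nonneg_of_le_pi_div_two (by positivity) ht.2 hlt
      rw [Real.sin_pi_div_four] at h1
      rw [Real.cos_pi_div_four] at h2
      linarith
    -- The torus makes both planar components nonnegative multiples of fixed axes; the swap puts the
    -- larger one first, which confines the angle to [0, π/4].
    rcases le_total s r with hsr | hsr
    · obtain ⟨t, ht, hc, hsn⟩ := exists_cos_sin_eq hr0 hs0 hrs
      refine ⟨t, ⟨ht.1, hle t ht (by rw [hc, hsn]; exact hsr)⟩, ⟨_, horth a b⟩, ?_, ?_⟩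
      · rw [hG]; exact ⟨a, b, Or.inl rfl⟩
      · apply S3.ext_ofLp
        rw [S3.coe_smul_ofLp]
        change torusMatrix a b *ᵥ v = ![Real.cos t, 0, Real.sin t, 0]
        rw [hT, hc, hsn]
    · obtain ⟨t, ht, hc, hsn⟩ := exists_cos_sin_eq hs0 hr0 (by linarith)
      refine ⟨t, ⟨ht.1, hle t ht (by rw [hc, hsn]; exact hsr)⟩, weylSwap * ⟨_, horth a b⟩, ?_, ?_⟩
      · rw [hG]
        exact ⟨b, a, Or.inr (weylSwap_mul_torusMatrix a b)⟩
      · apply S3.ext_ofLp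
        rw [S3.coe_smul_ofLp]
        change (weylSwap.1 * torusMatrix a b) *ᵥ v = ![Real.cos t, 0, Real.sin t, 0]
        rw [← mulVec_mulVec, hT, weylSwap_mulVec, hc, hsn]
        simp

theorem reflectionW_mul_blockMatrix (B : Matrix (Fin 3) (Fin 3) ℝ) :
    reflectionW.1 * blockMatrix B = blockMatrix B * reflectionW.1 := by
  ext i j
  fin_cases i <;> fin_cases j <;>
    simp [reflectionW, blockMatrix, Matrix.mul_apply, Fin.sum_univ_four]

theorem reflectionW_mul_self : reflectionW.1 * reflectionW.1 = 1 := by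
  ext i j
  fin_cases i <;> fin_cases j <;> simp [reflectionW, Matrix.mul_apply, Fin.sum_univ_four]

theorem star_reflectionW : star reflectionW.1 = reflectionW.1 := by
  ext i j
  fin_cases i <;> fin_cases j <;> simp [reflectionW, Matrix.star_apply]

theorem star_mem_specialOrthogonalGroup {B : Matrix (Fin 3) (Fin 3) ℝ}
    (hB : B ∈ Matrix.specialOrthogonalGroup (Fin 3) ℝ) :
    star B ∈ Matrix.specialOrthogonalGroup (Fin 3) ℝ := by
  rw [Matrix.mem_specialOrthogonalGroup_iff] at hB ⊢
  refine ⟨Unitary.star_mem hB.1, ?_⟩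
  rw [Matrix.star_eq_conjTranspose, Matrix.det_conjTranspose, hB.2, star_one]

/-- The product of `SO(3)` with the reflection in the last coordinate. -/
def rotationReflectionGroup : Subgroup O4 where
  carrier := {A | ∃ B ∈ Matrix.specialOrthogonalGroup (Fin 3) ℝ,
    A.1 = blockMatrix B ∨ A.1 = blockMatrix B * reflectionW.1}
  one_mem' := ⟨1, one_mem _, Or.inl blockMatrix_one.symm⟩
  mul_mem' := by
    rintro A A' ⟨B, hB, hA⟩ ⟨B', hB', hA'⟩
    have hAA : (A * A').1 = A.1 * A'.1 := rfl
    refine ⟨B * B', mul_mem hB hB', ?_⟩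
    rw [← blockMatrix_mul, hAA]
    rcases hA with hA | hA <;> rcases hA' with hA' | hA'
    · exact Or.inl (by rw [hA, hA'])
    · exact Or.inr (by rw [hA, hA', mul_assoc])
    · exact Or.inr (by rw [hA, hA', mul_assoc, reflectionW_mul_blockMatrix, mul_assoc])
    · left
      rw [hA, hA', mul_assoc, ← mul_assoc reflectionW.1, reflectionW_mul_blockMatrix,
        mul_assoc (blockMatrix B'), reflectionW_mul_self, mul_one]
  inv_mem' := by
    rintro A ⟨B, hB, hA⟩
    have hAi : (A⁻¹).1 = star A.1 := rfl
    refine ⟨star B, star_mem_specialOrthogonalGroup hB, ?_⟩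
    rw [hAi, ← blockMatrix_star]
    rcases hA with hA | hA
    · exact Or.inl (by rw [hA])
    · right
      rw [hA, star_mul, star_reflectionW, blockMatrix_star, reflectionW_mul_blockMatrix]

theorem rotationReflectionGroup_eq :
    rotationReflectionGroup = standardSO3 ⊔ Subgroup.zpowers reflectionW := by
  apply le_antisymm
  · have hw : reflectionW ∈ standardSO3 ⊔ Subgroup.zpowers reflectionW :=
      (le_sup_right : Subgroup.zpowers reflectionW ≤ _) (Subgroup.mem_zpowers _)
    have hT : standardSO3 ≤ standardSO3 ⊔ Subgroup.zpowers reflectionW := le_sup_left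
    rintro A ⟨B, hB, hA | hA⟩
    · exact hT ⟨B, hB, hA⟩
    · have h1 : A * reflectionW ∈ standardSO3 := ⟨B, hB, by
        change A.1 * reflectionW.1 = _
        rw [hA, mul_assoc, reflectionW_mul_self, mul_one]⟩
      have := Subgroup.mul_mem _ (hT h1) (Subgroup.inv_mem _ hw)
      rwa [mul_inv_cancel_right] at this
  · rw [sup_le_iff, Subgroup.zpowers_le]
    exact ⟨fun A ⟨B, hB, hA⟩ => ⟨B, hB, Or.inl hA⟩,
      1, one_mem _, Or.inr (by rw [blockMatrix_one, one_mul])⟩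

/-- Taking the upper left corner is a continuous left inverse of `blockMatrix`, so the image is cut
out by closed conditions. -/
theorem isClosed_blockMatrix_image : IsClosed (blockMatrix ''
    (Matrix.specialOrthogonalGroup (Fin 3) ℝ : Set (Matrix (Fin 3) (Fin 3) ℝ))) := by
  let S : M4 → Matrix (Fin 3) (Fin 3) ℝ := fun A => A.submatrix Fin.castSucc Fin.castSucc
  have hS : Continuous S := continuous_id.matrix_submatrix _ _
  have hb : Continuous blockMatrix := by
    refine continuous_matrix fun i j => ?_
    fin_cases i <;> fin_cases j <;> simp [blockMatrix] <;> fun_prop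
  have hSb : ∀ B, S (blockMatrix B) = B := fun B => by
    ext i j
    fin_cases i <;> fin_cases j <;> simp [S, blockMatrix]
  have hso : IsClosed (Matrix.specialOrthogonalGroup (Fin 3) ℝ :
      Set (Matrix (Fin 3) (Fin 3) ℝ)) := by
    have : (Matrix.specialOrthogonalGroup (Fin 3) ℝ : Set (Matrix (Fin 3) (Fin 3) ℝ)) =
        (unitary (Matrix (Fin 3) (Fin 3) ℝ) : Set (Matrix (Fin 3) (Fin 3) ℝ)) ∩
          {B | B.det = 1} := by
      ext B
      exact Matrix.mem_specialOrthogonalGroup_iff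
    rw [this]
    exact isClosed_unitary.inter (isClosed_eq (by fun_prop) continuous_const)
  have : blockMatrix '' (Matrix.specialOrthogonalGroup (Fin 3) ℝ :
      Set (Matrix (Fin 3) (Fin 3) ℝ)) = S ⁻¹' (Matrix.specialOrthogonalGroup (Fin 3) ℝ) ∩
        {A | blockMatrix (S A) = A} := by
    ext A
    constructor
    · rintro ⟨B, hB, rfl⟩
      exact ⟨by rw [Set.mem_preimage, hSb]; exact hB, by
        change blockMatrix (S _) = _
        rw [hSb]⟩
    · rintro ⟨h1, h2⟩
      exact ⟨S A, h1, h2⟩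
  rw [this]
  exact (hso.preimage hS).inter (isClosed_eq (hb.comp hS) continuous_id)

theorem isClosed_rotationReflectionGroup : IsClosed (rotationReflectionGroup : Set O4) := by
  have h1 : Continuous fun A : O4 => A.1 := continuous_subtype_val
  have h2 : Continuous fun A : O4 => A.1 * reflectionW.1 := h1.mul continuous_const
  have : (rotationReflectionGroup : Set O4) =
      (fun A : O4 => A.1) ⁻¹' (blockMatrix '' (Matrix.specialOrthogonalGroup (Fin 3) ℝ)) ∪
      (fun A : O4 => A.1 * reflectionW.1) ⁻¹'
        (blockMatrix '' (Matrix.specialOrthogonalGroup (Fin 3) ℝ)) := by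
    ext A
    constructor
    · rintro ⟨B, hB, hA | hA⟩
      · exact Or.inl ⟨B, hB, hA.symm⟩
      · refine Or.inr ⟨B, hB, ?_⟩
        change _ = A.1 * reflectionW.1
        rw [hA, mul_assoc, reflectionW_mul_self, mul_one]
    · rintro (⟨B, hB, hA⟩ | ⟨B, hB, hA⟩)
      · exact ⟨B, hB, Or.inl hA.symm⟩
      · refine ⟨B, hB, Or.inr ?_⟩
        rw [hA]
        change A.1 = A.1 * reflectionW.1 * reflectionW.1
        rw [mul_assoc, reflectionW_mul_self, mul_one]
  rw [this]
  exact (isClosed_blockMatrix_image.preimage h1).union (isClosed_blockMatrix_image.preimage h2)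

/-- One rotation in the first two coordinates clears the second entry; another, in the first and
third, clears the third. -/
theorem exists_rotation_to_axis (u : Fin 3 → ℝ) :
    ∃ B ∈ Matrix.specialOrthogonalGroup (Fin 3) ℝ,
      B *ᵥ u = ![√(u 0 ^ 2 + u 1 ^ 2 + u 2 ^ 2), 0, 0] := by
  obtain ⟨θ, h0, h1⟩ := exists_polar (u 0) (u 1)
  set ρ := √(u 0 ^ 2 + u 1 ^ 2) with hρ
  obtain ⟨φ, hr, h2⟩ := exists_polar ρ (u 2)
  have hρ2 : ρ ^ 2 = u 0 ^ 2 + u 1 ^ 2 := Real.sq_sqrt (by positivity)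
  rw [hρ2] at hr h2
  set r := √(u 0 ^ 2 + u 1 ^ 2 + u 2 ^ 2)
  let R₁ : Matrix (Fin 3) (Fin 3) ℝ :=
    !![Real.cos θ, Real.sin θ, 0; -Real.sin θ, Real.cos θ, 0; 0, 0, 1]
  let R₂ : Matrix (Fin 3) (Fin 3) ℝ :=
    !![Real.cos φ, 0, Real.sin φ; 0, 1, 0; -Real.sin φ, 0, Real.cos φ]
  have hR₁ : R₁ ∈ Matrix.specialOrthogonalGroup (Fin 3) ℝ := by
    rw [Matrix.mem_specialOrthogonalGroup_iff, Matrix.mem_orthogonalGroup_iff]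
    constructor
    · ext i j
      fin_cases i <;> fin_cases j <;>
        simp [R₁, Matrix.mul_apply, Fin.sum_univ_three, ← sq] <;> ring
    · simp [R₁, Matrix.det_fin_three, ← sq]
  have hR₂ : R₂ ∈ Matrix.specialOrthogonalGroup (Fin 3) ℝ := by
    rw [Matrix.mem_specialOrthogonalGroup_iff, Matrix.mem_orthogonalGroup_iff]
    constructor
    · ext i j
      fin_cases i <;> fin_cases j <;>
        simp [R₂, Matrix.mul_apply, Fin.sum_univ_three, ← sq] <;> ring
    · simp [R₂, Matrix.det_fin_three, ← sq]
  refine ⟨R₂ * R₁, mul_mem hR₂ hR₁, ?_⟩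
  have e1 : R₁ *ᵥ u = ![ρ, 0, u 2] := by
    ext i
    fin_cases i <;> simp [R₁, mulVec, dotProduct, Fin.sum_univ_three]
    · rw [h0, h1]; linear_combination ρ * Real.cos_sq_add_sin_sq θ
    · rw [h0, h1]; ring
  rw [← mulVec_mulVec, e1]
  ext i
  fin_cases i <;> simp [R₂, mulVec, dotProduct, Fin.sum_univ_three]
  · rw [hr, h2]; linear_combination r * Real.cos_sq_add_sin_sq φ
  · rw [hr, h2]; ring

theorem blockMatrix_mulVec (B : Matrix (Fin 3) (Fin 3) ℝ) (v : Fin 4 → ℝ) :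
    blockMatrix B *ᵥ v = ![(B *ᵥ ![v 0, v 1, v 2]) 0, (B *ᵥ ![v 0, v 1, v 2]) 1,
      (B *ᵥ ![v 0, v 1, v 2]) 2, v 3] := by
  ext i
  fin_cases i <;> simp [blockMatrix, mulVec, dotProduct, Fin.sum_univ_four, Fin.sum_univ_three]

theorem reflectionW_mulVec (v : Fin 4 → ℝ) : reflectionW.1 *ᵥ v = ![v 0, v 1, v 2, -v 3] := by
  ext i
  fin_cases i <;> simp [reflectionW, mulVec, dotProduct, Fin.sum_univ_four]

theorem blockMatrix_mem_orthogonalGroup {B : Matrix (Fin 3) (Fin 3) ℝ}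
    (hB : B ∈ Matrix.specialOrthogonalGroup (Fin 3) ℝ) :
    blockMatrix B ∈ Matrix.orthogonalGroup (Fin 4) ℝ := by
  refine Matrix.mem_unitaryGroup_iff.mpr ?_
  rw [blockMatrix_star, blockMatrix_mul,
    Matrix.mem_unitaryGroup_iff.mp (Matrix.mem_specialOrthogonalGroup_iff.mp hB).1,
    blockMatrix_one]

/-- The orbit space of `SO(3)` extended by the reflection in its axis is an interval of length
`π / 2`. -/
theorem orbitSpace_rotationReflectionGroup (G : ClosedSubgroup O4)
    (hG : G.toSubgroup = rotationReflectionGroup) :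
    orbitSpaceDim G = 1 ∧ orbitSpaceDiam G = Real.pi / 2 := by
  have hπ := Real.pi_pos
  refine orbitSpace_eq_interval G (by positivity) (by linarith)
    (fun t => S3.ofVec ![Real.sin t, 0, 0, Real.cos t] (by
      simp [dotProduct, Fin.sum_univ_four, ← sq])) ?_ ?_ ?_
  · intro s t
    simp [S3.ofVec, dotProduct, Fin.sum_univ_four, Real.cos_sub]
    ring
  · intro s hs t ht g hg
    rw [hG] at hg
    have hcs : 0 ≤ Real.cos s := Real.cos_nonneg_of_mem_Icc ⟨by linarith [hs.1], by linarith [hs.2]⟩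
    have hct : 0 ≤ Real.cos t := Real.cos_nonneg_of_mem_Icc ⟨by linarith [ht.1], by linarith [ht.2]⟩
    have hss : 0 ≤ Real.sin s := Real.sin_nonneg_of_nonneg_of_le_pi hs.1 (by linarith [hs.2])
    have hst : 0 ≤ Real.sin t := Real.sin_nonneg_of_nonneg_of_le_pi ht.1 (by linarith [ht.2])
    obtain ⟨B, hB, hg⟩ := hg
    have hB1 : B 0 0 ≤ 1 := by
      have := entry_norm_bound_of_unitary (𝕜 := ℝ)
        (Matrix.mem_specialOrthogonalGroup_iff.mp hB).1 0 0
      exact (le_abs_self _).trans this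
    have hbd : Real.sin s * Real.sin t * B 0 0 ≤ Real.sin s * Real.sin t :=
      mul_le_of_le_one_right (mul_nonneg hss hst) hB1
    -- On [0, π/2] both cosines are nonnegative, so reversing the last coordinate cannot increase
    -- the inner product.
    have hcc := mul_nonneg hcs hct
    rw [Real.cos_sub]
    rcases hg with hg | hg
    · have e : (![Real.sin s, 0, 0, Real.cos s] : Fin 4 → ℝ) ⬝ᵥ
          (g.1 *ᵥ ![Real.sin t, 0, 0, Real.cos t]) =
          Real.sin s * Real.sin t * B 0 0 + Real.cos s * Real.cos t := by
        rw [hg, blockMatrix_mulVec]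
        simp [mulVec, dotProduct, Fin.sum_univ_four, Fin.sum_univ_three]; ring
      refine e.trans_le ?_
      linarith
    · have e : (![Real.sin s, 0, 0, Real.cos s] : Fin 4 → ℝ) ⬝ᵥ
          (g.1 *ᵥ ![Real.sin t, 0, 0, Real.cos t]) =
          Real.sin s * Real.sin t * B 0 0 - Real.cos s * Real.cos t := by
        rw [hg, ← mulVec_mulVec, reflectionW_mulVec, blockMatrix_mulVec]
        simp [mulVec, dotProduct, Fin.sum_univ_four, Fin.sum_univ_three]; ring
      refine e.trans_le ?_
      linarith
  · intro x
    set v := x.1.ofLp with hv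
    obtain ⟨B, hB, hBv⟩ := exists_rotation_to_axis ![v 0, v 1, v 2]
    have hBmul : ∀ w : Fin 4 → ℝ, w 0 = v 0 → w 1 = v 1 → w 2 = v 2 → blockMatrix B *ᵥ w =
        ![√(v 0 ^ 2 + v 1 ^ 2 + v 2 ^ 2), 0, 0, w 3] := by
      intro w w0 w1 w2
      rw [blockMatrix_mulVec, w0, w1, w2, hBv]
      simp
    have hone : v 0 ^ 2 + v 1 ^ 2 + v 2 ^ 2 + v 3 ^ 2 = 1 := by
      rw [← x.dotProduct_self]
      simp [dotProduct, Fin.sum_univ_four, ← hv]; ring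
    set r := √(v 0 ^ 2 + v 1 ^ 2 + v 2 ^ 2) with hr
    have hr2 : r ^ 2 = v 0 ^ 2 + v 1 ^ 2 + v 2 ^ 2 := Real.sq_sqrt (by positivity)
    have hr0 : 0 ≤ r := Real.sqrt_nonneg _
    let b : O4 := ⟨_, blockMatrix_mem_orthogonalGroup hB⟩
    rcases le_total 0 (v 3) with h3 | h3
    · obtain ⟨t, ht, hc, hsn⟩ := exists_cos_sin_eq h3 hr0 (by linarith)
      refine ⟨t, ht, b, by rw [hG]; exact ⟨B, hB, Or.inl rfl⟩, S3.ext_ofLp ?_⟩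
      rw [S3.coe_smul_ofLp]
      change blockMatrix B *ᵥ v = ![Real.sin t, 0, 0, Real.cos t]
      rw [hBmul v rfl rfl rfl, hc, hsn]
    · obtain ⟨t, ht, hc, hsn⟩ := exists_cos_sin_eq (neg_nonneg.mpr h3) hr0 (by
        rw [neg_sq]; linarith)
      refine ⟨t, ht, b * reflectionW, by rw [hG]; exact ⟨B, hB, Or.inr rfl⟩, S3.ext_ofLp ?_⟩
      rw [S3.coe_smul_ofLp]
      change (blockMatrix B * reflectionW.1) *ᵥ v = ![Real.sin t, 0, 0, Real.cos t]
      rw [← mulVec_mulVec, reflectionW_mulVec, hBmul ![v 0, v 1, v 2, -v 3] rfl rfl rfl, hc, hsn]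
      simp

end Examples
end

theorem mainTheorem7 :
    IsLeast {δ : ℝ | ∃ G : ClosedSubgroup O4, orbitSpaceDim G = 1 ∧ orbitSpaceDiam G = δ}
      (Real.pi / 4) ∧
    (∃ G : ClosedSubgroup O4, G.toSubgroup = torusT2 ⊔ Subgroup.zpowers weylSwap ∧
      orbitSpaceDim G = 1 ∧ orbitSpaceDiam G = Real.pi / 4) ∧
    (∃ G : ClosedSubgroup O4, G.toSubgroup = standardSO3 ⊔ Subgroup.zpowers reflectionW ∧
      orbitSpaceDim G = 1 ∧ orbitSpaceDiam G = Real.pi / 2) := by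
  refine ⟨⟨⟨⟨torusSwapGroup, isClosed_torusSwapGroup⟩, orbitSpace_torusSwapGroup _ rfl⟩, ?_⟩,
    ⟨⟨torusSwapGroup, isClosed_torusSwapGroup⟩, torusSwapGroup_eq,
      orbitSpace_torusSwapGroup _ rfl⟩,
    ⟨⟨rotationReflectionGroup, isClosed_rotationReflectionGroup⟩, rotationReflectionGroup_eq,
      orbitSpace_rotationReflectionGroup _ rfl⟩⟩
  rintro δ ⟨G, hdim, rfl⟩
  exact pi_div_four_le_orbitSpaceDiam hdim
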